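/- Let $K$ be a field, let $S=K[x_1,\dots,x_m,y_1,\dots,y_n]$ be the polynomial ring with its standard bigrading $\deg x_i=(1,0)$, $\deg y_j=(0,1)$, let $Q=(y_1,\dots,y_n)$, and let $M$ be a finitely generated ($\mathbb{Z}^2$-)bigraded $S$-module. For an $S$-module $N$ let $\operatorname{cd}(Q,N)$ be the largest $i$ with $H^i_Q(N)\neq 0$ (and $\operatorname{cd}(Q,0)=-\infty$), and call $N$ Cohen–Macaulay with respect to $Q$ if there is an integer $q$ such that $H^i_Q(N)=0$ for all $i\neq q$. A Cohen–Macaulay filtration of $M$ with respect to $Q$ is a finite filtration $0=M_0\subsetneq M_1\subsetneq\dots\subsetneq M_r=M$ by bigraded submodules such that each $M_i/M_{i-1}$ is Cohen–Macaulay with respect to $Q$ and $0\le \operatorname{cd}(Q,M_1/M_0)<\operatorname{cd}(Q,M_2/M_1)<\dots<\operatorname{cd}(Q,M_r/M_{r-1})$. A dimension filtration of $M$ with respect to $Q$ is a finite filtration $0=M_0\subsetneq M_1\subsetneq\dots\subsetneq M_r=M$ by bigraded submodules such that, for each $i=1,\dots,r$, $M_{i-1}$ is the largest bigraded submodule $N$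 of $M_i$ with $\operatorname{cd}(Q,N)<\operatorname{cd}(Q,M_i)$. Let $\mathcal{F}$ be a Cohen–Macaulay filtration of $M$ with respect to $Q$. Then $\mathcal{F}$ is a dimension filtration of $M$ with respect to $Q$, and $\mathcal{F}=\mathcal{G}$ for every dimension filtration $\mathcal{G}$ of $M$ with respect to $Q$. In particular, the Cohen–Macaulay filtration of $M$ with respect to $Q$ is unique if it exists: $\mathcal{F}=\mathcal{F}'$ for every Cohen–Macaulay filtration $\mathcal{F}'$ of $M$ with respect to $Q$. -/

import Mathlib

universe u

namespace BigradedCM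

section LocalCohomology

variable {R : Type u} [CommRing R]

/-- The cohomological dimension of `M` with respect to the ideal `J`: the supremum of all `i` with
`Hⁱ_J(M) ≠ 0`. It is `⊥` if all local cohomology modules vanish, in particular for `M = 0`. -/
noncomputable def cd (J : Ideal R) (M : Type u) [AddCommGroup M] [Module R M] : WithBot ℕ∞ :=
  ⨆ (i : ℕ) (_ : Nontrivial ((localCohomology J i).obj (ModuleCat.of R M))), ((i : ℕ∞) : WithBot ℕ∞)

/-- `M` is (relative) Cohen–Macaulay with respect to `J`: for some integer `q`,
`Hⁱ_J(M) = 0` for all `i ≠ q`. -/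
def IsRelCohenMacaulay (J : Ideal R) (M : Type u) [AddCommGroup M] [Module R M] : Prop :=
  ∃ q : ℤ, ∀ i : ℕ, (i : ℤ) ≠ q →
    Subsingleton ((localCohomology J i).obj (ModuleCat.of R M))

end LocalCohomology

section Bigraded

variable (K : Type u) [Field K] (m n : ℕ)

/-- The polynomial ring `K[x₁, …, xₘ, y₁, …, yₙ]`; the left summand indexes the `x`-variables,
the right summand the `y`-variables. -/
abbrev PolyRing : Type u := MvPolynomial (Fin m ⊕ Fin n) K

/-- The standard bidegrees of the variables: `deg xᵢ = (1, 0)` and `deg yⱼ = (0, 1)`. -/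
def varDegree : Fin m ⊕ Fin n → ℤ × ℤ :=
  Sum.elim (fun _ => (1, 0)) (fun _ => (0, 1))

/-- The standard bigrading of `K[x₁, …, xₘ, y₁, …, yₙ]`. -/
noncomputable def stdBigrading (d : ℤ × ℤ) : Submodule K (PolyRing K m n) :=
  MvPolynomial.weightedHomogeneousSubmodule K (varDegree m n) d

/-- The ideal `Q = (y₁, …, yₙ)`. -/
noncomputable def idealQ : Ideal (PolyRing K m n) :=
  Ideal.span (Set.range fun j : Fin n => MvPolynomial.X (Sum.inr j))

variable {K m n}
variable {M : Type u} [AddCommGroup M] [Module (PolyRing K m n) M]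

/-- A finite filtration `0 = M₀ ⊊ M₁ ⊊ ⋯ ⊊ Mᵣ = M` of the bigraded module `M = ⨁ ℳ d` by
bigraded submodules; an `LTSeries` is a finite strictly increasing chain, and `r` is its length. -/
def IsBigradedFiltration (ℳ : ℤ × ℤ → AddSubgroup M) [DirectSum.Decomposition ℳ]
    (F : LTSeries (Submodule (PolyRing K m n) M)) : Prop :=
  F.head = ⊥ ∧ F.last = ⊤ ∧ ∀ i, (F i).IsHomogeneous ℳ

/-- The quotient `Mᵢ₊₁ / Mᵢ` of a filtration, for `0 ≤ i < r`. -/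
abbrev FactorModule (F : LTSeries (Submodule (PolyRing K m n) M)) (i : Fin F.length) : Type u :=
  (F i.succ) ⧸ (F i.castSucc).submoduleOf (F i.succ)

/-- Cohen–Macaulay filtrations with respect to `Q`. -/
structure IsCMFiltration (ℳ : ℤ × ℤ → AddSubgroup M) [DirectSum.Decomposition ℳ]
    (F : LTSeries (Submodule (PolyRing K m n) M)) : Prop where
  isFiltration : IsBigradedFiltration ℳ F
  factor_cm : ∀ i, IsRelCohenMacaulay (idealQ K m n) (FactorModule F i)
  cd_nonneg : ∀ i, 0 ≤ cd (idealQ K m n) (FactorModule F i)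
  cd_strictMono : StrictMono fun i => cd (idealQ K m n) (FactorModule F i)

/-- Dimension filtrations with respect to `Q`: each `Mᵢ` is the largest bigraded submodule `N` of
`Mᵢ₊₁` for which `cd(Q, N) < cd(Q, Mᵢ₊₁)`. -/
structure IsDimensionFiltration (ℳ : ℤ × ℤ → AddSubgroup M) [DirectSum.Decomposition ℳ]
    (F : LTSeries (Submodule (PolyRing K m n) M)) : Prop where
  isFiltration : IsBigradedFiltration ℳ F
  isGreatest : ∀ i : Fin F.length,
    IsGreatest {N : Submodule (PolyRing K m n) M | N.IsHomogeneous ℳ ∧ N ≤ F i.succ ∧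
      cd (idealQ K m n) N < cd (idealQ K m n) (F i.succ)} (F i.castSucc)

end Bigraded

end BigradedCM

/-! Let `C = Mᵢ / Mᵢ₋₁` have its only nonzero local cohomology in degree `q = qᵢ`. As the `qᵢ`
increase, the long exact sequences give `cd(Q, Mᵢ) = qᵢ` and `cd(Q, Mᵢ₋₁) < qᵢ`. What has to be
shown is that a bigraded `N ≤ Mᵢ` with `cd(Q, N) < q` has zero image in `C` (`le_of_cd_lt`).
Uniqueness is then formal: a dimension filtration is determined from the top down.

Two facts force the image to vanish. The first is that a nonzero `N` has `a ≤ cd(Q, N)` elements of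
`Q` which together with `ann N` generate `Q` up to radical (`exists_parameters_not_van`). Take `a`
minimal among systems of forms `θ₁, …, θₐ` of one bidegree `(0, e)` with `Qˢ N ⊆ (θ) N`. Put `P =
(x₁, …, xₘ)` and `A = K[X₁, …, Xₐ]`, acting through `θ`. Then `N / P N` is finite over `A`, and
minimality makes it non-torsion: a form killing it could replace one parameter. So there is a
nonzero `A`-linear map `N / P N → A`. If `Hᵃ(N)` vanished, so would the colimit of the `N / (θ₁ᵗ, …,
θₐᵗ) N`, and the map would carry this to a relation that monomials in `A` forbid.

The second is a relative Ischebeck theorem (`exists_sub_one_smul_ext_eq_zero`): since `Hⁱ(C) = 0`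
for `i < q` and `a < q`, every map `N → C` is killed by some `1 - r` with `r ∈ Q`. Elements of `1 +
Q` act injectively modulo bigraded submodules, by degree reasons (`mem_of_one_sub_smul_mem`), so the
map is zero.

All vanishing statements are handled through Yoneda `Ext`, where long exact sequences are available
(`subsingleton_localCohomology_iff`). -/

namespace BigradedCM

/-! ### Local cohomology through Yoneda `Ext` -/

section ExtComparison

open CategoryTheory Limits Opposite

variable {R : Type u} [CommRing R]

/-- The functor `Hom(-, Y)` used in the definition of `Ext`. -/
noncomputable abbrev homFunctor (Y : ModuleCat.{u} R) : ModuleCat.{u} R ⥤ (ModuleCat.{u} R)ᵒᵖ :=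
  ((linearYoneda R (ModuleCat.{u} R)).obj Y).rightOp

variable {A : ModuleCat.{u} R} (P : ProjectiveResolution A) (Y : ModuleCat.{u} R) (n : ℕ)

noncomputable abbrev homComplex : ChainComplex (ModuleCat.{u} R)ᵒᵖ ℕ :=
  ((homFunctor Y).mapHomologicalComplex _).obj P.complex

noncomputable def leftDerivedIso :
    ((homFunctor Y).leftDerived n).obj A ≅ (homComplex P Y).homology n :=
  P.isoLeftDerivedObj (homFunctor Y) n

noncomputable def homOpcyclesToExt :
    unop ((homComplex P Y).opcycles n) ⟶ ((Ext R (ModuleCat.{u} R) n).obj (op A)).obj Y :=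
  ((leftDerivedIso P Y n).hom ≫ (homComplex P Y).homologyι n).unop

noncomputable def homOpcyclesι :
    unop ((homComplex P Y).opcycles n) ⟶ ModuleCat.of R (P.complex.X n ⟶ Y) :=
  ((homComplex P Y).pOpcycles n).unop

/-- The cochain `φ` is a cocycle that represents the element `x` of `Ext`. -/
def Represents (φ : P.complex.X n ⟶ Y)
    (x : ((Ext R (ModuleCat.{u} R) n).obj (op A)).obj Y) : Prop :=
  ∃ z, homOpcyclesι P Y n z = φ ∧ homOpcyclesToExt P Y n z = x

variable {P Y n}

lemma Represents.exists_of_elem (x : ((Ext R (ModuleCat.{u} R) n).obj (op A)).obj Y) :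
    ∃ φ, Represents P Y n φ x := by
  have : Epi (homOpcyclesToExt P Y n) := by
    unfold homOpcyclesToExt
    exact unop_epi_of_mono _
  obtain ⟨z, hz⟩ := (ModuleCat.epi_iff_surjective _).1 this x
  exact ⟨_, z, rfl, hz⟩

lemma Represents.d_comp {φ : P.complex.X n ⟶ Y} {x} (h : Represents P Y n φ x) (m : ℕ) :
    P.complex.d m n ≫ φ = 0 := by
  obtain ⟨z, rfl, -⟩ := h
  have := congrArg Quiver.Hom.unop ((homComplex P Y).d_pOpcycles m n)
  exact congr($this z)

lemma Represents.exists_of_cocycle {φ : P.complex.X n ⟶ Y} (h : P.complex.d (n + 1) n ≫ φ = 0) :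
    ∃ x, Represents P Y n φ x := by
  have hex : (ShortComplex.mk _ _ ((homComplex P Y).d_pOpcycles (n + 1) n)).Exact :=
    ShortComplex.exact_of_g_is_cokernel _ ((homComplex P Y).opcyclesIsCokernel (n + 1) n (by simp))
  have hex' := hex.unop
  rw [ShortComplex.moduleCat_exact_iff] at hex'
  obtain ⟨z, hz⟩ := hex' φ h
  exact ⟨_, z, hz, rfl⟩

lemma extMk_zero_eq_zero_iff {φ : P.complex.X 0 ⟶ Y} (m : ℕ) (hm : 0 + 1 = m)
    (hφ : P.complex.d m 0 ≫ φ = 0) : P.extMk φ m hm hφ = 0 ↔ φ = 0 := by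
  refine ⟨fun h => ?_, fun h => by subst h; simp⟩
  rw [← P.extEquivCohomologyClass.apply_eq_iff_eq, P.extEquivCohomologyClass_extMk,
    P.extEquivCohomologyClass_zero, CochainComplex.HomComplex.CohomologyClass.mk_eq_zero_iff,
    CochainComplex.HomComplex.Cocycle.toSingleMk_mem_coboundaries_iff _ _ _ _ _ 1 (by simp)] at h
  obtain ⟨g, hg⟩ := h
  have h0 : IsZero (P.cochainComplex.X 1) := by
    exact P.cochainComplex.isZero_of_isStrictlyLE 0 1 (by simp)
  rw [h0.eq_of_src g 0, comp_zero] at hg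
  rw [← cancel_epi (P.cochainComplexXIso (-(0:ℕ)) 0 rfl).hom, ← hg, comp_zero]

/-- Both kinds of `Ext` are computed by the same cochains on the resolution, so a class is zero in
either exactly when `φ` is a coboundary. `Represents` thus transports vanishing without an explicit
isomorphism between the two theories. -/
lemma Represents.eq_zero_iff {φ : P.complex.X n ⟶ Y} {x} (h : Represents P Y n φ x) :
    x = 0 ↔ P.extMk φ (n + 1) rfl (h.d_comp _) = 0 := by
  have hex : (ShortComplex.mk _ _ ((homComplex P Y).homologyι_comp_fromOpcycles n (n - 1))).Exact :=
    ShortComplex.exact_of_f_is_kernel _ ((homComplex P Y).homologyIsKernel n (n - 1) (by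
      cases n <;> simp))
  have hex' := hex.unop
  rw [ShortComplex.moduleCat_exact_iff] at hex'
  have hp := congrArg Quiver.Hom.unop ((homComplex P Y).p_fromOpcycles n (n - 1))
  have hι := congrArg Quiver.Hom.unop ((homComplex P Y).homologyι_comp_fromOpcycles n (n - 1))
  have hmono : Mono (homOpcyclesι P Y n) := by
    exact unop_mono_of_epi _
  have hinj := (ModuleCat.mono_iff_injective _).1 hmono
  -- For `n = 0` the truncated `n - 1` is `0` and `d 0 0 = 0`, so the right-hand side correctly says
  -- `φ = 0`.
  have key : x = 0 ↔ ∃ g : P.complex.X (n - 1) ⟶ Y, P.complex.d n (n - 1) ≫ g = φ := by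
    obtain ⟨z, rfl, rfl⟩ := h
    constructor
    · intro h0
      have h1 : ((homComplex P Y).homologyι n).unop z = 0 := by
        have h2 : (leftDerivedIso P Y n).hom.unop (((homComplex P Y).homologyι n).unop z) = 0 := h0
        have h3 := congrArg ((leftDerivedIso P Y n).inv.unop) h2
        have h4 := congrArg Quiver.Hom.unop (leftDerivedIso P Y n).inv_hom_id
        have h5 := congr($h4 (((homComplex P Y).homologyι n).unop z))
        rw [map_zero] at h3
        exact h5.symm.trans h3
      obtain ⟨g, hg⟩ := hex' z h1
      refine ⟨g, ?_⟩
      rw [← hg]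
      exact congr($hp g).symm
    · rintro ⟨g, hg⟩
      have hz : z = ((homComplex P Y).fromOpcycles n (n - 1)).unop g := by
        apply hinj
        rw [← hg]
        exact congr($hp g).symm
      have h1 : ((homComplex P Y).homologyι n).unop z = 0 := by
        rw [hz]
        exact congr($hι g)
      have h2 : (leftDerivedIso P Y n).hom.unop (((homComplex P Y).homologyι n).unop z) = 0 := by
        rw [h1, map_zero]
      exact h2
  rw [key]
  cases n with
  | zero =>
    rw [extMk_zero_eq_zero_iff]
    constructor
    · rintro ⟨g, rfl⟩; simp
    · rintro rfl; exact ⟨0, by simp⟩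
  | succ k => exact (P.extMk_eq_zero_iff _ _ _ _ k rfl).symm

lemma leftDerivedIso_naturality {A' : ModuleCat.{u} R} {P' : ProjectiveResolution A'} {f : A' ⟶ A}
    (g : P'.Hom P f) :
    ((homFunctor Y).leftDerived n).map f ≫ (leftDerivedIso P Y n).hom =
      (leftDerivedIso P' Y n).hom ≫ HomologicalComplex.homologyMap
        (((homFunctor Y).mapHomologicalComplex _).map g.hom) n :=
  P'.isoLeftDerivedObj_hom_naturality f P g.hom (by simpa using g.hom_f_zero_comp_π_f_zero)
    (homFunctor Y) n

lemma Represents.map {A' : ModuleCat.{u} R} {P' : ProjectiveResolution A'} {f : A' ⟶ A}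
    (g : P'.Hom P f) {φ : P.complex.X n ⟶ Y} {x} (h : Represents P Y n φ x) :
    Represents P' Y n (g.hom.f n ≫ φ) (((Ext R (ModuleCat.{u} R) n).map f.op).app Y x) := by
  obtain ⟨z, rfl, rfl⟩ := h
  let G : homComplex P' Y ⟶ homComplex P Y := ((homFunctor Y).mapHomologicalComplex _).map g.hom
  refine ⟨(HomologicalComplex.opcyclesMap G n).unop z, ?_, ?_⟩
  · have := congrArg Quiver.Hom.unop (HomologicalComplex.p_opcyclesMap G n)
    exact congr($this z)
  · have h3 : ((homFunctor Y).leftDerived n).map f ≫ (leftDerivedIso P Y n).hom ≫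
        (homComplex P Y).homologyι n = (leftDerivedIso P' Y n).hom ≫
        (homComplex P' Y).homologyι n ≫ HomologicalComplex.opcyclesMap G n := by
      rw [← HomologicalComplex.homologyι_naturality, ← Category.assoc,
        leftDerivedIso_naturality g, Category.assoc]
    have := congrArg Quiver.Hom.unop h3
    exact congr($this z).symm

lemma map_ext_eq_zero_iff {A' : ModuleCat.{u} R} (P' : ProjectiveResolution A') {f : A' ⟶ A}
    {φ : P.complex.X n ⟶ Y} {x} (h : Represents P Y n φ x) :
    ((Ext R (ModuleCat.{u} R) n).map f.op).app Y x = 0 ↔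
      (Abelian.Ext.mk₀ f).comp (P.extMk φ (n + 1) rfl (h.d_comp _)) (zero_add n) = 0 := by
  let g : P'.Hom P f := ⟨ProjectiveResolution.lift f P' P, by
    rw [← HomologicalComplex.comp_f, ← HomologicalComplex.comp_f,
      ProjectiveResolution.lift_commutes]⟩
  rw [(h.map g).eq_zero_iff, ProjectiveResolution.mk₀_comp_extMk _ _ _ _ g]

/-- The canonical projection `R ⧸ J ^ t' ⟶ R ⧸ J ^ t` for `t ≤ t'`. -/
noncomputable def powProj (J : Ideal R) {t t' : ℕ} (h : t ≤ t') :
    ModuleCat.of R (R ⧸ J ^ t') ⟶ ModuleCat.of R (R ⧸ J ^ t) :=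
  ModuleCat.ofHom (Submodule.mapQ _ _ LinearMap.id (Ideal.pow_le_pow_right h))

/-- Vanishing of local cohomology, expressed through Yoneda `Ext` groups: each class of
`Extⁱ(R ⧸ J ^ t, Y)` dies in some `Extⁱ(R ⧸ J ^ t', Y)`. -/
def Vanishes (J : Ideal R) (i : ℕ) (Y : ModuleCat.{u} R) : Prop :=
  ∀ (t : ℕ) (e : Abelian.Ext (ModuleCat.of R (R ⧸ J ^ t)) Y i), ∃ (t' : ℕ) (h : t ≤ t'),
    (Abelian.Ext.mk₀ (powProj J h)).comp e (zero_add i) = 0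

/-- Local cohomology is a filtered colimit of `Ext` groups, and such a colimit is zero iff every
element dies at some later stage. Representing cocycles translate this to Yoneda `Ext`. -/
theorem subsingleton_localCohomology_iff (J : Ideal R) (i : ℕ) (Y : ModuleCat.{u} R) :
    Subsingleton ((localCohomology J i).obj Y) ↔ Vanishes J i Y := by
  let F := localCohomology.diagram (localCohomology.idealPowersDiagram J) i
  let G := F ⋙ (evaluation _ _).obj Y
  let e : (localCohomology J i).obj Y ≅ colimit G := colimitObjIsoColimitCompEvaluation F Y
  have he : Subsingleton ((localCohomology J i).obj Y) ↔ Subsingleton (colimit G :) :=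
    e.toLinearEquiv.toEquiv.subsingleton_congr
  have : PreservesFilteredColimitsOfSize.{0, 0} (forget (ModuleCat.{u} R)) :=
    preservesFilteredColimitsOfSize_shrink.{0, u, 0, u} _
  let P (t : ℕ) : ProjectiveResolution (ModuleCat.of R (R ⧸ J ^ t)) := projectiveResolution _
  have hmap : ∀ (t t' : ℕ) (h : t ≤ t') (f : op (op t) ⟶ op (op t')) (x : G.obj (op (op t))),
      G.map f x = ((Ext R (ModuleCat.{u} R) i).map (powProj J h).op).app Y x := fun _ _ _ _ _ => rfl
  have hcrit : Subsingleton (colimit G :) ↔ ∀ (t : ℕ) (x : G.obj (op (op t))), ∃ (t' : ℕ) (h : t ≤ t'),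
      ((Ext R (ModuleCat.{u} R) i).map (powProj J h).op).app Y x = 0 := by
    constructor
    · intro hs t x
      have h0 : colimit.ι G (op (op t)) x = colimit.ι G (op (op t)) 0 := Subsingleton.elim _ _
      obtain ⟨k, f, g, hk⟩ := (Concrete.colimit_rep_eq_iff_exists G _ _).1 h0
      induction k using Opposite.rec with | _ k => ?_
      induction k using Opposite.rec with | _ k => ?_
      have hle : t ≤ k := leOfHom f.unop.unop
      refine ⟨k, hle, ?_⟩
      rw [← hmap t k hle f]
      exact hk.trans (map_zero _)
    · intro h
      refine subsingleton_of_forall_eq 0 fun y => ?_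
      obtain ⟨k, x, rfl⟩ := Concrete.colimit_exists_rep G y
      induction k using Opposite.rec with | _ k => ?_
      induction k using Opposite.rec with | _ k => ?_
      obtain ⟨t', hle, ht⟩ := h k x
      let f : op (op k) ⟶ op (op t') := (homOfLE hle).op.op
      rw [← hmap k t' hle f] at ht
      rw [← colimit.w G f]
      exact (congrArg (colimit.ι G (op (op t'))) ht).trans (map_zero _)
  rw [he, hcrit]
  constructor
  · intro h t e
    obtain ⟨φ, hφ, rfl⟩ := (P t).extMk_surjective e (i + 1) rfl
    obtain ⟨x, hx⟩ := Represents.exists_of_cocycle hφ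
    obtain ⟨t', hle, h0⟩ := h t x
    exact ⟨t', hle, (map_ext_eq_zero_iff (P t') hx).1 h0⟩
  · intro h t x
    obtain ⟨φ, hφ⟩ := Represents.exists_of_elem (P := P t) x
    obtain ⟨t', hle, h0⟩ := h t ((P t).extMk φ (i + 1) rfl (hφ.d_comp _))
    exact ⟨t', hle, (map_ext_eq_zero_iff (P t') hφ).2 h0⟩

end ExtComparison
-- Long exact sequence rules and torsion modules
section VanishingRules

open CategoryTheory Limits Opposite

variable {R : Type u} [CommRing R] (J : Ideal R)

lemma powProj_comp_powProj {a b c : ℕ} (h : a ≤ b) (h' : b ≤ c) :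
    powProj J h' ≫ powProj J h = powProj J (h.trans h') := by
  ext
  rfl

lemma comp_powProj {Y : ModuleCat.{u} R} {i a b c : ℕ} (h : a ≤ b) (h' : b ≤ c)
    (e : Abelian.Ext (ModuleCat.of R (R ⧸ J ^ a)) Y i) :
    (Abelian.Ext.mk₀ (powProj J h')).comp
      ((Abelian.Ext.mk₀ (powProj J h)).comp e (zero_add i)) (zero_add i) =
      (Abelian.Ext.mk₀ (powProj J (h.trans h'))).comp e (zero_add i) := by
  rw [Abelian.Ext.mk₀_comp_mk₀_assoc, powProj_comp_powProj]

section ShortExact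

variable {J} {S : ShortComplex (ModuleCat.{u} R)} (hS : S.ShortExact) {i : ℕ}
include hS

/-- Exactness in the colimit, done by hand: pass to a stage where the image in `X₃` dies, lift to
`X₁`, and pass to a stage where the lift dies. `Vanishes.right` and `Vanishes.left` use the same two
passes with the connecting map. -/
lemma Vanishes.middle (h₁ : Vanishes J i S.X₁) (h₃ : Vanishes J i S.X₃) : Vanishes J i S.X₂ := by
  intro t e
  obtain ⟨t', ht', h⟩ := h₃ t (e.comp (Abelian.Ext.mk₀ S.g) (add_zero i))
  rw [← Abelian.Ext.comp_assoc_of_third_deg_zero] at h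
  obtain ⟨x, hx⟩ := Abelian.Ext.covariant_sequence_exact₂ _ hS _ h
  obtain ⟨t'', ht'', h'⟩ := h₁ t' x
  refine ⟨t'', ht'.trans ht'', ?_⟩
  rw [← comp_powProj J ht' ht'', ← hx, ← Abelian.Ext.comp_assoc_of_third_deg_zero, h',
    Abelian.Ext.zero_comp]

lemma Vanishes.right (h₂ : Vanishes J i S.X₂) (h₁ : Vanishes J (i + 1) S.X₁) :
    Vanishes J i S.X₃ := by
  intro t e
  obtain ⟨t', ht', h⟩ := h₁ t (e.comp hS.extClass rfl)
  rw [← Abelian.Ext.comp_assoc _ _ _ (zero_add i) _ (by omega)] at h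
  obtain ⟨x, hx⟩ := Abelian.Ext.covariant_sequence_exact₃ _ hS _ rfl h
  obtain ⟨t'', ht'', h'⟩ := h₂ t' x
  refine ⟨t'', ht'.trans ht'', ?_⟩
  rw [← comp_powProj J ht' ht'', ← hx, ← Abelian.Ext.comp_assoc_of_third_deg_zero, h',
    Abelian.Ext.zero_comp]

lemma Vanishes.left (h₂ : Vanishes J (i + 1) S.X₂) (h₃ : Vanishes J i S.X₃) :
    Vanishes J (i + 1) S.X₁ := by
  intro t e
  obtain ⟨t', ht', h⟩ := h₂ t (e.comp (Abelian.Ext.mk₀ S.f) (add_zero _))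
  rw [← Abelian.Ext.comp_assoc_of_third_deg_zero] at h
  obtain ⟨x, hx⟩ := Abelian.Ext.covariant_sequence_exact₁ _ hS _ h rfl
  obtain ⟨t'', ht'', h'⟩ := h₃ t' x
  refine ⟨t'', ht'.trans ht'', ?_⟩
  rw [← comp_powProj J ht' ht'', ← hx, ← Abelian.Ext.comp_assoc _ _ _ (zero_add i) _ (by omega), h',
    Abelian.Ext.zero_comp]

end ShortExact

/-- Vanishing of the `i`-th local cohomology of an unbundled module. -/
abbrev Van (i : ℕ) (X : Type u) [AddCommGroup X] [Module R X] : Prop :=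
  Vanishes J i (ModuleCat.of R X)

section Unbundled

variable {J} {X Y Z : Type u} [AddCommGroup X] [Module R X] [AddCommGroup Y] [Module R Y]
  [AddCommGroup Z] [Module R Z] {f : X →ₗ[R] Y} {g : Y →ₗ[R] Z}

/-- The short complex attached to an exact pair of linear maps. -/
abbrev shortComplexOf (hfg : Function.Exact f g) : ShortComplex (ModuleCat.{u} R) :=
  ShortComplex.mk (ModuleCat.ofHom f) (ModuleCat.ofHom g)
    (by ext x; exact hfg.apply_apply_eq_zero x)

lemma shortExact_of (hf : Function.Injective f) (hfg : Function.Exact f g)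
    (hg : Function.Surjective g) : (shortComplexOf hfg).ShortExact :=
  ModuleCat.shortComplex_shortExact _ hfg hf hg

variable (hf : Function.Injective f) (hfg : Function.Exact f g) (hg : Function.Surjective g) {i : ℕ}
include hf hfg hg

lemma Van.middle (h₁ : Van J i X) (h₃ : Van J i Z) : Van J i Y :=
  Vanishes.middle (shortExact_of hf hfg hg) h₁ h₃

lemma Van.right (h₂ : Van J i Y) (h₁ : Van J (i + 1) X) : Van J i Z :=
  Vanishes.right (shortExact_of hf hfg hg) h₂ h₁

lemma Van.left (h₂ : Van J (i + 1) Y) (h₃ : Van J i Z) : Van J (i + 1) X :=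
  Vanishes.left (shortExact_of hf hfg hg) h₂ h₃

end Unbundled

section

variable {J} {X Y : Type u} [AddCommGroup X] [Module R X] [AddCommGroup Y] [Module R Y] {i : ℕ}

lemma Van.of_subsingleton [Subsingleton X] : Van J i X := by
  intro t e
  refine ⟨t, le_rfl, ?_⟩
  have h0 : IsZero (ModuleCat.of R X) := ModuleCat.isZero_of_subsingleton _
  rw [← Abelian.Ext.comp_mk₀_id e, h0.eq_of_src (𝟙 _) 0]
  simp

lemma Van.of_linearEquiv (e : X ≃ₗ[R] Y) (h : Van J i X) : Van J i Y :=
  Van.middle (f := e.toLinearMap) (g := (0 : Y →ₗ[R] PUnit.{u + 1})) e.injective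
    (fun y => ⟨fun _ => e.surjective y, fun _ => rfl⟩) (fun _ => ⟨0, rfl⟩) h Van.of_subsingleton

lemma eq_zero_of_van_zero (h : Van J 0 X) (t : ℕ) (x : X) (hx : ∀ r ∈ J ^ t, r • x = 0) :
    x = 0 := by
  let f : (R ⧸ J ^ t) →ₗ[R] X := Submodule.liftQ _ (LinearMap.toSpanSingleton R X x) (by
    intro r hr
    simpa using hx r hr)
  obtain ⟨t', ht', h0⟩ := h t (Abelian.Ext.mk₀ (ModuleCat.ofHom f))
  rw [Abelian.Ext.mk₀_comp_mk₀] at h0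
  have h1 := (Abelian.Ext.mk₀_bijective _ _).1 (h0.trans (Abelian.Ext.mk₀_zero _ _).symm)
  have h2 := congr($h1 (Ideal.Quotient.mk _ 1 : R ⧸ J ^ t'))
  have h3 : f (Submodule.Quotient.mk 1) = 0 := h2
  have h4 : f (Submodule.Quotient.mk 1) = LinearMap.toSpanSingleton R X x 1 :=
    Submodule.liftQ_apply _ _ _
  simpa using h4.symm.trans h3

/-- If some element of `J` acts bijectively, all local cohomology vanishes. -/
lemma van_of_bijective {y : R} (hy : y ∈ J) (hb : Function.Bijective (fun x : X => y • x)) :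
    Van J i X := by
  intro t e
  refine ⟨t, le_rfl, ?_⟩
  suffices e = 0 by simp [this]
  have hbt : Function.Bijective (fun x : X => y ^ t • x) := by
    have := hb.iterate t
    convert this using 2 with x
    rw [smul_iterate]
  let E : X ≃ₗ[R] X := LinearEquiv.ofBijective (y ^ t • LinearMap.id) hbt
  -- The scalar `y ^ t` can act on either argument of `Ext`: on `R ⧸ J ^ t` it is zero, on `X` it is
  -- an automorphism. Hence `e = 0`.
  have h1 : y ^ t • e = 0 := by
    have : y ^ t • (𝟙 (ModuleCat.of R (R ⧸ J ^ t))) = 0 := by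
      ext
      have : y ^ t • (Submodule.Quotient.mk 1 : R ⧸ J ^ t) = 0 := by
        rw [← Submodule.Quotient.mk_smul, Submodule.Quotient.mk_eq_zero]
        simpa using Ideal.pow_mem_pow hy t
      exact this
    rw [← Abelian.Ext.mk₀_id_comp e, ← Abelian.Ext.smul_comp, ← Abelian.Ext.mk₀_smul, this]
    simp
  have h2 : e.comp (Abelian.Ext.mk₀ (ModuleCat.ofHom E.toLinearMap)) (add_zero i) = 0 := by
    rw [← h1, Abelian.Ext.smul_eq_comp_mk₀]
    congr 2
  have h3 : ModuleCat.ofHom E.toLinearMap ≫ ModuleCat.ofHom E.symm.toLinearMap =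
      𝟙 (ModuleCat.of R X) := by
    ext x
    exact E.symm_apply_apply x
  rw [← Abelian.Ext.comp_mk₀_id e, ← h3, ← Abelian.Ext.mk₀_comp_mk₀,
    ← Abelian.Ext.comp_assoc_of_third_deg_zero, h2, Abelian.Ext.zero_comp]

end

/-- Every element is killed by a power of `J`. -/
def IsPowTorsion (X : Type u) [AddCommGroup X] [Module R X] : Prop :=
  ∀ x : X, ∃ t, ∀ r ∈ J ^ t, r • x = 0

/-- The submodule of elements killed by a power of `J`. -/
def gammaSub (X : Type u) [AddCommGroup X] [Module R X] : Submodule R X where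
  carrier := {x | ∃ t, ∀ r ∈ J ^ t, r • x = 0}
  zero_mem' := ⟨0, by simp⟩
  add_mem' := by
    rintro x y ⟨s, hs⟩ ⟨t, ht⟩
    refine ⟨s + t, fun r hr => ?_⟩
    rw [smul_add, hs r (Ideal.pow_le_pow_right (by omega) hr),
      ht r (Ideal.pow_le_pow_right (by omega) hr), add_zero]
  smul_mem' := by
    rintro c x ⟨s, hs⟩
    exact ⟨s, fun r hr => by rw [smul_comm, hs r hr, smul_zero]⟩

variable {J} in
lemma exists_pow_smul_eq_zero_of_fg {X : Type u} [AddCommGroup X] [Module R X] {N : Submodule R X}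
    (hN : N.FG) (hle : N ≤ gammaSub J X) : ∃ t, ∀ x ∈ N, ∀ r ∈ J ^ t, r • x = 0 := by
  induction N, hN using Submodule.fg_induction with
  | singleton x =>
    obtain ⟨t, ht⟩ := hle (Submodule.mem_span_singleton_self x)
    refine ⟨t, fun y hy r hr => ?_⟩
    obtain ⟨c, rfl⟩ := Submodule.mem_span_singleton.1 hy
    rw [smul_comm, ht r hr, smul_zero]
  | sup N₁ N₂ h₁ h₂ ih₁ ih₂ =>
    obtain ⟨s, hs⟩ := ih₁ (le_sup_left.trans hle)
    obtain ⟨t, ht⟩ := ih₂ (le_sup_right.trans hle)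
    refine ⟨s + t, fun x hx r hr => ?_⟩
    obtain ⟨y, hy, z, hz, rfl⟩ := Submodule.mem_sup.1 hx
    rw [smul_add, hs y hy r (Ideal.pow_le_pow_right (by omega) hr),
      ht z hz r (Ideal.pow_le_pow_right (by omega) hr), add_zero]

/-- Baer's criterion with Artin–Rees. The image of `f : I → Γ_J(E)` is killed by some `J ^ t`, and
`J ^ (t + k) ∩ I ⊆ J ^ t I'` with `I' = J ^ k ∩ I`, so `f` kills `J ^ (t + k) ∩ I` and factors
through a submodule of `R ⧸ J ^ (t + k)`. An extension of it to `R ⧸ J ^ (t + k) → E` automatically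
has torsion values. -/
lemma injective_gammaSub [IsNoetherianRing R] (E : Type u) [AddCommGroup E] [Module R E]
    [hE : Module.Injective R E] : Module.Injective R (gammaSub J E) := by
  apply Module.Baer.injective
  intro I f
  obtain ⟨t, ht⟩ : ∃ t, ∀ x : I, ∀ r ∈ J ^ t, r • (f x : E) = 0 := by
    have hfg : (LinearMap.range ((gammaSub J E).subtype ∘ₗ f)).FG := by
      rw [LinearMap.range_eq_map]
      exact Submodule.FG.map _ Module.Finite.fg_top
    obtain ⟨t, ht⟩ := exists_pow_smul_eq_zero_of_fg (J := J) hfg (by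
      rintro _ ⟨x, rfl⟩
      exact (f x).2)
    exact ⟨t, fun x r hr => ht _ ⟨x, rfl⟩ r hr⟩
  obtain ⟨k, hk⟩ := Ideal.exists_pow_inf_eq_pow_smul (M := R) J I
  have hker : ∀ x : I, (x : R) ∈ J ^ (t + k) → (f x : E) = 0 := by
    have hle : J ^ t • (J ^ k • (⊤ : Submodule R R) ⊓ I) ≤ (LinearMap.ker f).map I.subtype := by
      refine Submodule.smul_le.2 fun r hr a ha => ⟨⟨r • a, I.smul_mem r ha.2⟩, ?_, rfl⟩
      rw [SetLike.mem_coe, LinearMap.mem_ker]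
      have : f ⟨r • a, I.smul_mem r ha.2⟩ = r • f ⟨a, ha.2⟩ := by rw [← map_smul]; rfl
      rw [this]
      exact Subtype.ext (ht _ r hr)
    intro x hx
    have hx' : (x : R) ∈ J ^ (t + k) • (⊤ : Submodule R R) ⊓ I := ⟨by simpa using hx, x.2⟩
    rw [hk (t + k) (by omega), Nat.add_sub_cancel] at hx'
    obtain ⟨y, hy, hyx⟩ := hle hx'
    obtain rfl : y = x := Subtype.ext hyx
    simp [LinearMap.mem_ker.1 hy]
  let q : I →ₗ[R] R ⧸ J ^ (t + k) := (Submodule.mkQ (J ^ (t + k))) ∘ₗ I.subtype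
  have hq : LinearMap.ker q ≤ LinearMap.ker ((gammaSub J E).subtype ∘ₗ f) := by
    intro x hx
    refine hker x ?_
    simpa [q, Ideal.Quotient.eq_zero_iff_mem] using hx
  obtain ⟨h, hh⟩ := hE.out ((LinearMap.ker q).liftQ q le_rfl)
    (LinearMap.ker_eq_bot.1 (Submodule.ker_liftQ_eq_bot _ _ _ le_rfl))
    ((LinearMap.ker q).liftQ ((gammaSub J E).subtype ∘ₗ f) hq)
  refine ⟨LinearMap.codRestrict _ (h ∘ₗ Submodule.mkQ (J ^ (t + k))) fun r => ⟨t + k, fun c hc => ?_⟩,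
    fun x hx => Subtype.ext ?_⟩
  · rw [← map_smul, LinearMap.comp_apply]
    have : Submodule.mkQ (J ^ (t + k)) (c • r) = 0 := by
      rw [Submodule.mkQ_apply, Submodule.Quotient.mk_eq_zero]
      exact Ideal.mul_mem_right _ _ hc
    rw [this, map_zero]
  · have := hh (Submodule.Quotient.mk ⟨x, hx⟩)
    rw [Submodule.liftQ_apply, Submodule.liftQ_apply] at this
    exact this

variable {J} in
lemma IsPowTorsion.exists_embedding [IsNoetherianRing R] {X : Type u} [AddCommGroup X] [Module R X]
    (hX : IsPowTorsion J X) : ∃ (E : Type u) (_ : AddCommGroup E) (_ : Module R E)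
      (f : X →ₗ[R] E), Module.Injective R E ∧ IsPowTorsion J E ∧ Function.Injective f := by
  let E₀ := Injective.under (ModuleCat.of R X)
  have : Module.Injective R E₀ := Module.injective_module_of_injective_object (inj :=
    inferInstanceAs (Injective E₀)) R E₀
  let ι : X →ₗ[R] E₀ := (Injective.ι (ModuleCat.of R X)).hom
  have hι : Function.Injective ι := (ModuleCat.mono_iff_injective _).1
    (inferInstanceAs (Mono (Injective.ι (ModuleCat.of R X))))
  refine ⟨gammaSub J E₀, inferInstance, inferInstance, LinearMap.codRestrict _ ι fun x => ?_,
    injective_gammaSub J E₀, ?_, fun x y hxy => hι (congrArg Subtype.val hxy)⟩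
  · obtain ⟨t, ht⟩ := hX x
    exact ⟨t, fun r hr => by rw [← map_smul, ht r hr, map_zero]⟩
  · rintro ⟨x, t, ht⟩
    exact ⟨t, fun r hr => Subtype.ext (ht r hr)⟩

variable {J} in
/-- Local cohomology of a torsion module vanishes in positive degrees. -/
theorem IsPowTorsion.van [IsNoetherianRing R] (i : ℕ) : ∀ {X : Type u} [AddCommGroup X]
    [Module R X], IsPowTorsion J X → Van J (i + 1) X := by
  induction i with
  | zero =>
    intro X _ _ hX t e
    obtain ⟨E, _, _, f, hE, hET, hf⟩ := hX.exists_embedding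
    have := Module.injective_object_of_injective_module R E
    have hS := shortExact_of hf (g := (LinearMap.range f).mkQ)
      (LinearMap.exact_iff.2 (by simp)) (Submodule.mkQ_surjective _)
    obtain ⟨x, hx⟩ := Abelian.Ext.covariant_sequence_exact₁ _ hS e
      (Abelian.Ext.eq_zero_of_injective _) rfl
    obtain ⟨p, rfl⟩ := (Abelian.Ext.mk₀_bijective _ _).2 x
    -- The class `e` is the connecting image of `p : R ⧸ J ^ t → E / X`. A lift `z` of `p 1` is
    -- killed by some `J ^ s`, so over `R ⧸ J ^ (t + s)` the map `p` lifts to `E` and its connecting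
    -- image is zero.
    obtain ⟨z, hz⟩ := Submodule.mkQ_surjective (LinearMap.range f)
      (p.hom (Submodule.Quotient.mk 1 : R ⧸ J ^ t))
    obtain ⟨s, hs⟩ := hET z
    let p' : (R ⧸ J ^ (t + s)) →ₗ[R] E := Submodule.liftQ _ (LinearMap.toSpanSingleton R E z) (by
      intro r hr
      simpa using hs r (Ideal.pow_le_pow_right (by omega) hr))
    have hp1 : p' (Submodule.Quotient.mk 1) = z :=
      (Submodule.liftQ_apply _ _ _).trans (one_smul R z)
    refine ⟨t + s, by omega, ?_⟩
    have hp : powProj J (show t ≤ t + s by omega) ≫ p =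
        ModuleCat.ofHom p' ≫ (shortComplexOf (LinearMap.exact_iff.2 (by simp) :
          Function.Exact f (LinearMap.range f).mkQ)).g := by
      ext
      exact hz.symm.trans (congrArg (LinearMap.range f).mkQ hp1.symm)
    rw [← hx, Abelian.Ext.mk₀_comp_mk₀_assoc, hp, ← Abelian.Ext.mk₀_comp_mk₀_assoc,
      ShortComplex.ShortExact.comp_extClass]
    simp
  | succ i ih =>
    intro X _ _ hX
    obtain ⟨E, _, _, f, hE, hET, hf⟩ := hX.exists_embedding
    have := Module.injective_object_of_injective_module R E
    refine Van.left hf (g := (LinearMap.range f).mkQ) (LinearMap.exact_iff.2 (by simp))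
      (Submodule.mkQ_surjective _) ?_ (ih ?_)
    · intro t e
      exact ⟨t, le_rfl, by rw [Abelian.Ext.eq_zero_of_injective e]; simp⟩
    · intro y
      obtain ⟨y, rfl⟩ := Submodule.mkQ_surjective _ y
      obtain ⟨t, ht⟩ := hET y
      exact ⟨t, fun r hr => by rw [← map_smul, ht r hr, map_zero]⟩

end VanishingRules
-- A relative Ischebeck theorem
section Ischebeck

open CategoryTheory Limits Opposite

variable {R : Type u} [CommRing R] [IsNoetherianRing R] {J : Ideal R}

/-- Yoneda `Ext` of unbundled modules. -/
abbrev ExtMod (R : Type u) [CommRing R] (X Y : Type u) [AddCommGroup X] [Module R X]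
    [AddCommGroup Y] [Module R Y] (i : ℕ) : Type u :=
  Abelian.Ext (ModuleCat.of R X) (ModuleCat.of R Y) i

section

variable {X Y Z C : Type u} [AddCommGroup X] [Module R X] [AddCommGroup Y] [Module R Y]
  [AddCommGroup Z] [Module R Z] [AddCommGroup C] [Module R C]

omit [IsNoetherianRing R] in
lemma ext_eq_zero_of_surjective {g : Y →ₗ[R] Z} (hg : Function.Surjective g) {j : ℕ}
    (hK : ∀ k < j, Subsingleton (ExtMod R (LinearMap.ker g) C k)) (e : ExtMod R Z C j)
    (he : (Abelian.Ext.mk₀ (ModuleCat.ofHom g)).comp e (zero_add j) = 0) : e = 0 := by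
  have hS := shortExact_of (f := (LinearMap.ker g).subtype) (g := g) (Submodule.subtype_injective _)
    (LinearMap.exact_subtype_ker_map g) hg
  cases j with
  | zero =>
    obtain ⟨f, rfl⟩ := (Abelian.Ext.mk₀_bijective _ _).2 e
    rw [Abelian.Ext.mk₀_comp_mk₀] at he
    have h1 := (Abelian.Ext.mk₀_bijective _ _).1 (he.trans (Abelian.Ext.mk₀_zero _ _).symm)
    have : Epi (ModuleCat.ofHom g) := (ModuleCat.epi_iff_surjective _).2 hg
    rw [(cancel_epi (ModuleCat.ofHom g)).1 (h1.trans comp_zero.symm)]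
    simp
  | succ k =>
    obtain ⟨x, hx⟩ := Abelian.Ext.contravariant_sequence_exact₃ hS _ e he (add_comm 1 k)
    have := hK k (Nat.lt_succ_self k)
    rw [← hx, Subsingleton.elim x 0]
    simp

end

variable (C : Type u) [AddCommGroup C] [Module R C] {q : ℕ}

/-- Induction on `j`. A class on `R ⧸ J ^ t` dies on some `R ⧸ J ^ t'`; the kernel of the projection
is again `J`-torsion, so its lower `Ext` groups vanish and the pullback is injective. The same
argument along `R ⧸ J → R ⧸ p` and a prime filtration give all `T`. -/
lemma subsingleton_ext_of_le_radical (hC : ∀ i < q, Van J i C) (j : ℕ) (hj : j < q)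
    (T : Type u) [AddCommGroup T] [Module R T] [hT : Module.Finite R T]
    (hJT : J ≤ (Module.annihilator R T).radical) : Subsingleton (ExtMod R T C j) := by
  induction j using Nat.strong_induction_on generalizing T with
  | _ j ih =>
  have step (t : ℕ) : Subsingleton (ExtMod R (R ⧸ J ^ t) C j) := by
    refine subsingleton_of_forall_eq 0 fun e => ?_
    obtain ⟨t', ht', h0⟩ := hC j hj t e
    let g : (R ⧸ J ^ t') →ₗ[R] (R ⧸ J ^ t) :=
      Submodule.mapQ _ _ LinearMap.id (Ideal.pow_le_pow_right ht')
    have hg : Function.Surjective g := by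
      intro x
      obtain ⟨x, rfl⟩ := Submodule.mkQ_surjective _ x
      exact ⟨Submodule.Quotient.mk x, rfl⟩
    refine ext_eq_zero_of_surjective hg (fun k hk => ih k hk (hk.trans hj) _ fun r hr => ?_) e h0
    refine ⟨t', Module.mem_annihilator.2 fun x => Subtype.ext ?_⟩
    obtain ⟨y, hy⟩ := Submodule.mkQ_surjective _ (x : R ⧸ J ^ t')
    change r ^ t' • (x : R ⧸ J ^ t') = 0
    rw [← hy, ← map_smul, Submodule.mkQ_apply, Submodule.Quotient.mk_eq_zero]
    exact Ideal.mul_mem_right _ _ (Ideal.pow_mem_pow hr _)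
  induction hT using IsNoetherianRing.induction_on_isQuotientEquivQuotientPrime R with
  | subsingleton N =>
    refine subsingleton_of_forall_eq 0 fun e => ?_
    have h0 : IsZero (ModuleCat.of R N) := ModuleCat.isZero_of_subsingleton _
    rw [← Abelian.Ext.mk₀_id_comp e, h0.eq_of_src (𝟙 _) 0]
    simp
  | quotient N p a =>
    have hp : J ^ 1 ≤ p.asIdeal := by
      rw [pow_one]
      refine hJT.trans (p.2.radical_le_iff.2 ?_)
      rw [a.annihilator_eq, Ideal.annihilator_quotient]
    let g : (R ⧸ J ^ 1) →ₗ[R] N := a.symm.toLinearMap ∘ₗ Submodule.mapQ _ _ LinearMap.id hp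
    have hg : Function.Surjective g := by
      refine a.symm.surjective.comp fun x => ?_
      obtain ⟨x, rfl⟩ := Submodule.mkQ_surjective _ x
      exact ⟨Submodule.Quotient.mk x, rfl⟩
    refine subsingleton_of_forall_eq 0 fun e => ?_
    have := step 1
    refine ext_eq_zero_of_surjective hg (fun k hk => ih k hk (hk.trans hj) _ fun r hr => ?_) e
      (Subsingleton.elim _ _)
    refine ⟨1, Module.mem_annihilator.2 fun x => Subtype.ext ?_⟩
    obtain ⟨y, hy⟩ := Submodule.mkQ_surjective _ (x : R ⧸ J ^ 1)
    change r ^ 1 • (x : R ⧸ J ^ 1) = 0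
    rw [← hy, ← map_smul, Submodule.mkQ_apply, Submodule.Quotient.mk_eq_zero]
    exact Ideal.mul_mem_right _ _ (Ideal.pow_mem_pow hr _)
  | exact N₁ N₂ N₃ f g hf hg hfg h₁ h₃ =>
    have := h₁ (hJT.trans (Ideal.radical_mono (f.annihilator_le_of_injective hf)))
    have := h₃ (hJT.trans (Ideal.radical_mono (g.annihilator_le_of_surjective hg)))
    refine subsingleton_of_forall_eq 0 fun e => ?_
    obtain ⟨x, hx⟩ := Abelian.Ext.contravariant_sequence_exact₂ (shortExact_of hf hfg hg) _ e
      (Subsingleton.elim _ _)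
    rw [← hx, Subsingleton.elim x 0]
    simp

/-- A relative form of Ischebeck's theorem. -/
theorem exists_sub_one_smul_ext_eq_zero [Module.Finite R C] (hC : ∀ i < q, Van J i C) (l : List R)
    (hl : ∀ x ∈ l, x ∈ J) (j : ℕ) (hj : j + l.length < q)
    (N : Type u) [AddCommGroup N] [Module R N] [hN : Module.Finite R N]
    (hJN : J ≤ (Module.annihilator R N ⊔ Ideal.span {x | x ∈ l}).radical) :
    ∃ r ∈ J, ∀ e : ExtMod R N C j, (1 - r) • e = 0 := by
  induction l generalizing j N with
  | nil =>
    have := subsingleton_ext_of_le_radical C hC j (by simpa using hj) N (by simpa using hJN)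
    exact ⟨0, J.zero_mem, fun e => Subsingleton.elim _ _⟩
  | cons θ l ih =>
  have hset : ({x | x ∈ θ :: l} : Set R) = insert θ {x | x ∈ l} := by ext; simp
  rw [hset, Ideal.span_insert] at hJN
  simp only [List.length_cons] at hj
  have hl' : ∀ x ∈ l, x ∈ J := fun x hx => hl x (List.mem_cons_of_mem _ hx)
  have hθ : θ ∈ J := hl θ List.mem_cons_self
  induction hN using IsNoetherianRing.induction_on_isQuotientEquivQuotientPrime R with
  | subsingleton N =>
    refine ⟨0, J.zero_mem, fun e => ?_⟩
    have h0 : IsZero (ModuleCat.of R N) := ModuleCat.isZero_of_subsingleton _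
    rw [← Abelian.Ext.mk₀_id_comp e, h0.eq_of_src (𝟙 _) 0]
    simp
  | quotient N p a =>
    have hann : Module.annihilator R N = p.asIdeal := by
      rw [a.annihilator_eq, Ideal.annihilator_quotient]
    -- If `θ ∈ p`, it is redundant beside the annihilator. Otherwise `θ` is regular on `N`, and
    -- passing to `N / θ N` trades one parameter for one cohomological degree, which keeps `j +
    -- l.length` fixed.
    by_cases hθp : θ ∈ p.asIdeal
    · refine ih hl' j (by omega) N (hJN.trans (Ideal.radical_mono ?_))
      refine sup_le le_sup_left (sup_le ?_ le_sup_right)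
      rw [hann, Ideal.span_singleton_le_iff_mem]
      exact Ideal.mem_sup_left hθp
    · let f : N →ₗ[R] N := θ • LinearMap.id
      have hf : Function.Injective f := by
        rw [← LinearMap.ker_eq_bot, LinearMap.ker_eq_bot']
        intro x hx
        obtain ⟨y, hy⟩ := Submodule.mkQ_surjective _ (a x)
        have h1 : θ • a x = 0 := by
          rw [← map_smul]
          exact (congrArg a hx).trans (map_zero a)
        rw [← hy, ← map_smul, Submodule.mkQ_apply, Submodule.Quotient.mk_eq_zero] at h1
        have h2 := (p.2.mem_or_mem h1).resolve_left hθp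
        rw [← a.map_eq_zero_iff, ← hy, Submodule.mkQ_apply, Submodule.Quotient.mk_eq_zero]
        exact h2
      have hfg : Function.Exact f (LinearMap.range f).mkQ := LinearMap.exact_iff.2 (by simp)
      have hS := shortExact_of hf hfg (Submodule.mkQ_surjective _)
      obtain ⟨r, hr, hr0⟩ := ih hl' (j + 1) (by omega) (N ⧸ LinearMap.range f) (by
        refine hJN.trans (Ideal.radical_mono ?_)
        rw [← sup_assoc]
        refine sup_le_sup_right (sup_le ?_ ?_) _
        · exact LinearMap.annihilator_le_of_surjective _ (Submodule.mkQ_surjective _)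
        · rw [Ideal.span_singleton_le_iff_mem, Module.mem_annihilator]
          intro x
          obtain ⟨x, rfl⟩ := Submodule.mkQ_surjective _ x
          rw [← map_smul, Submodule.mkQ_apply, Submodule.Quotient.mk_eq_zero]
          exact ⟨x, rfl⟩)
      have hfin : Module.Finite R (ExtMod R N C j) := ModuleCat.finite_ext R _ _ j
      -- The cokernel of `θ` on `E = Ext^j(N, C)` embeds in `Ext^(j+1)(N / θ N, C)`, which is killed
      -- by `1 - r`. So `E = r E + θ E ⊆ J E`, and Nakayama applies because `E` is finite.
      obtain ⟨s, hs, hs0⟩ := Submodule.exists_sub_one_mem_and_smul_eq_zero_of_fg_of_le_smul J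
        (⊤ : Submodule R (ExtMod R N C j)) hfin.fg_top (by
          intro e _
          have h0 : hS.extClass.comp ((1 - r) • e) (add_comm 1 j) = 0 := by
            rw [Abelian.Ext.comp_smul]
            exact hr0 _
          obtain ⟨x, hx⟩ := Abelian.Ext.contravariant_sequence_exact₁ hS _ _ (add_comm 1 j) h0
          have hx' : θ • x = (1 - r) • e := by
            rw [← hx, ← Abelian.Ext.mk₀_id_comp x, ← Abelian.Ext.smul_comp,
              ← Abelian.Ext.mk₀_smul, Abelian.Ext.mk₀_id_comp]
            congr 2
          have he : e = r • e + θ • x := by rw [hx', ← add_smul]; simp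
          rw [he]
          exact Submodule.add_mem _ (Submodule.smul_mem_smul hr trivial)
            (Submodule.smul_mem_smul hθ trivial))
      exact ⟨1 - s, by simpa using J.neg_mem hs, fun e => by simpa using hs0 e trivial⟩
  | exact N₁ N₂ N₃ f g hf hg hfg h₁ h₃ =>
    obtain ⟨r₁, hr₁, h₁⟩ := h₁ (hJN.trans (Ideal.radical_mono
      (sup_le_sup_right (f.annihilator_le_of_injective hf) _)))
    obtain ⟨r₃, hr₃, h₃⟩ := h₃ (hJN.trans (Ideal.radical_mono
      (sup_le_sup_right (g.annihilator_le_of_surjective hg) _)))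
    refine ⟨r₁ + r₃ - r₃ * r₁, J.sub_mem (J.add_mem hr₁ hr₃) (J.mul_mem_left _ hr₁), fun e => ?_⟩
    have hS := shortExact_of hf hfg hg
    obtain ⟨x, hx⟩ := Abelian.Ext.contravariant_sequence_exact₂ hS _ ((1 - r₁) • e) (by
      rw [Abelian.Ext.comp_smul]
      exact h₁ _)
    have : (1 - (r₁ + r₃ - r₃ * r₁)) • e = (1 - r₃) • (1 - r₁) • e := by
      rw [smul_smul]; congr 1; ring
    rw [this, ← hx, ← Abelian.Ext.comp_smul]
    exact (congrArg (fun z => (Abelian.Ext.mk₀ (shortComplexOf hfg).g).comp z (zero_add j))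
      (h₃ x)).trans (Abelian.Ext.comp_zero _ _ _ _ _)

/-- If `C` has no local cohomology below degree `q` and `N` has fewer than `q` parameters, then
maps `N → C` are killed by an element of `1 + J`. -/
theorem exists_sub_one_smul_hom_eq_zero [Module.Finite R C] (hC : ∀ i < q, Van J i C) (l : List R)
    (hl : ∀ x ∈ l, x ∈ J) (hj : l.length < q)
    (N : Type u) [AddCommGroup N] [Module R N] [hN : Module.Finite R N]
    (hJN : J ≤ (Module.annihilator R N ⊔ Ideal.span {x | x ∈ l}).radical) (f : N →ₗ[R] C) :
    ∃ r ∈ J, ∀ x, (1 - r) • f x = 0 := by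
  obtain ⟨r, hr, h⟩ := exists_sub_one_smul_ext_eq_zero C hC l hl 0 (by simpa using hj) N hJN
  refine ⟨r, hr, fun x => ?_⟩
  have h0 := h (Abelian.Ext.mk₀ (ModuleCat.ofHom f))
  rw [← Abelian.Ext.mk₀_smul] at h0
  have h1 := (Abelian.Ext.mk₀_bijective _ _).1 (h0.trans (Abelian.Ext.mk₀_zero _ _).symm)
  exact congr($h1 x)

end Ischebeck
-- Top local cohomology by successive localization
section LocalizationCokernel

variable {R : Type u} [CommRing R]

/-- The localization `X_θ`. -/
abbrev Away (θ : R) (X : Type u) [AddCommGroup X] [Module R X] : Type u :=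
  LocalizedModule (Submonoid.powers θ) X

/-- The canonical map `X → X_θ`. -/
noncomputable abbrev toAway (θ : R) (X : Type u) [AddCommGroup X] [Module R X] : X →ₗ[R] Away θ X :=
  LocalizedModule.mkLinearMap (Submonoid.powers θ) X

/-- The cokernel `X_θ / X`. -/
abbrev AwayCoker (θ : R) (X : Type u) [AddCommGroup X] [Module R X] : Type u :=
  Away θ X ⧸ LinearMap.range (toAway θ X)

variable {J : Ideal R} {θ : R} {X : Type u} [AddCommGroup X] [Module R X]

lemma bijective_smul_away : Function.Bijective (fun x : Away θ X => θ • x) := by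
  have := IsLocalizedModule.map_units (toAway θ X) (⟨θ, Submonoid.mem_powers θ⟩ : Submonoid.powers θ)
  exact (Module.End.isUnit_iff _).1 this

lemma exists_pow_smul_eq_toAway (z : Away θ X) : ∃ (k : ℕ) (x : X), θ ^ k • z = toAway θ X x := by
  obtain ⟨⟨x, ⟨_, k, rfl⟩⟩, hx⟩ := IsLocalizedModule.surj (Submonoid.powers θ) (toAway θ X) z
  exact ⟨k, x, hx⟩

lemma exists_pow_smul_eq_of_toAway_eq {x y : X} (h : toAway θ X x = toAway θ X y) :
    ∃ k : ℕ, θ ^ k • x = θ ^ k • y := by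
  obtain ⟨⟨_, k, rfl⟩, hk⟩ :=
    (IsLocalizedModule.eq_iff_exists (Submonoid.powers θ) (toAway θ X)).1 h
  exact ⟨k, hk⟩

lemma isPowTorsion_sup_span_of {I : Ideal R} {Y : Type u} [AddCommGroup Y] [Module R Y]
    (h : ∀ y : Y, ∃ k : ℕ, θ ^ k • y = 0 ∧ ∃ s : ℕ, ∀ r ∈ I ^ s, r • y = 0) :
    IsPowTorsion (I ⊔ Ideal.span {θ}) Y := by
  intro y
  obtain ⟨k, hk, s, hs⟩ := h y
  refine ⟨s + k, fun r hr => ?_⟩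
  have hr' := Ideal.sup_pow_add_le_pow_sup_pow hr
  rw [Ideal.span_singleton_pow] at hr'
  obtain ⟨a, ha, b, hb, rfl⟩ := Submodule.mem_sup.1 hr'
  obtain ⟨c, rfl⟩ := Ideal.mem_span_singleton'.1 hb
  rw [add_smul, hs a ha, mul_smul, hk]
  simp

lemma isPowTorsion_ker_toAway {I : Ideal R} (hX : IsPowTorsion I X) :
    IsPowTorsion (I ⊔ Ideal.span {θ}) (LinearMap.ker (toAway θ X)) := by
  refine isPowTorsion_sup_span_of fun y => ?_
  obtain ⟨k, hk⟩ := exists_pow_smul_eq_of_toAway_eq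
    ((LinearMap.mem_ker.1 y.2).trans (map_zero (toAway θ X)).symm)
  obtain ⟨s, hs⟩ := hX y
  exact ⟨k, Subtype.ext (by simpa using hk), s, fun r hr => Subtype.ext (hs r hr)⟩

lemma isPowTorsion_awayCoker {I : Ideal R} (hX : IsPowTorsion I X) :
    IsPowTorsion (I ⊔ Ideal.span {θ}) (AwayCoker θ X) := by
  refine isPowTorsion_sup_span_of fun y => ?_
  obtain ⟨z, rfl⟩ := Submodule.mkQ_surjective _ y
  obtain ⟨k, x, hx⟩ := exists_pow_smul_eq_toAway z
  refine ⟨k, ?_, ?_⟩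
  · rw [← map_smul, hx, Submodule.mkQ_apply, Submodule.Quotient.mk_eq_zero]
    exact ⟨x, rfl⟩
  · obtain ⟨s, hs⟩ := hX x
    refine ⟨s, fun r hr => ?_⟩
    rw [← map_smul]
    suffices r • z = 0 by rw [this, map_zero]
    apply (bijective_smul_away (θ := θ) (X := X)).1.iterate k
    rw [smul_iterate]
    simp only [smul_zero]
    rw [smul_comm, hx, ← map_smul, hs r hr, map_zero]

lemma exists_pow_smul_mem_of_mem_smul_top (I : Ideal R) {w : Away θ X}
    (hw : w ∈ I • (⊤ : Submodule R (Away θ X))) :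
    ∃ (k : ℕ) (x : X), x ∈ I • (⊤ : Submodule R X) ∧ θ ^ k • w = toAway θ X x := by
  induction hw using Submodule.smul_induction_on' with
  | smul r hr z _ =>
    obtain ⟨k, x, hx⟩ := exists_pow_smul_eq_toAway z
    exact ⟨k, r • x, Submodule.smul_mem_smul hr trivial, by rw [smul_comm, hx, map_smul]⟩
  | add w₁ _ w₂ _ h₁ h₂ =>
    obtain ⟨k₁, x₁, hx₁, e₁⟩ := h₁
    obtain ⟨k₂, x₂, hx₂, e₂⟩ := h₂
    refine ⟨k₁ + k₂, θ ^ k₂ • x₁ + θ ^ k₁ • x₂, Submodule.add_mem _ (Submodule.smul_mem _ _ hx₁)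
      (Submodule.smul_mem _ _ hx₂), ?_⟩
    rw [map_add, map_smul, map_smul, ← e₁, ← e₂, smul_smul, smul_smul, smul_add, pow_add,
      mul_comm (θ ^ k₂)]

/-- Multiplication by the product to the power `v` is the well-defined transition map `X / (θᵢᵃ) X →
X / (θᵢᵃ⁺ᵛ) X`. -/
lemma prod_pow_smul_mem (l : List R) {a : ℕ} (v : ℕ) {x : X}
    (hx : x ∈ Ideal.span ((· ^ a) '' {y | y ∈ l}) • (⊤ : Submodule R X)) :
    l.prod ^ v • x ∈ Ideal.span ((· ^ (a + v)) '' {y | y ∈ l}) • (⊤ : Submodule R X) := by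
  have h1 : l.prod ^ v • x ∈ (Ideal.span {l.prod ^ v} * Ideal.span ((· ^ a) '' {y | y ∈ l})) •
      (⊤ : Submodule R X) := by
    rw [Submodule.mul_smul]
    exact Submodule.smul_mem_smul (Ideal.mem_span_singleton_self _) hx
  refine Submodule.smul_mono_left ?_ h1
  rw [Ideal.span_mul_span', Ideal.span_le]
  rintro _ ⟨_, rfl, _, ⟨y, hy, rfl⟩, rfl⟩
  obtain ⟨c, hc⟩ := pow_dvd_pow_of_dvd (List.dvd_prod hy) v
  have : l.prod ^ v * y ^ a = c * y ^ (a + v) := by rw [hc]; ring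
  change l.prod ^ v * y ^ a ∈ _
  rw [this]
  exact Ideal.mul_mem_left _ _ (Ideal.subset_span ⟨y, hy, rfl⟩)

variable [IsNoetherianRing R]

omit [IsNoetherianRing R] in
lemma IsPowTorsion.of_le_radical {I : Ideal R} (hJ : J.FG) (hJI : J ≤ I.radical)
    (hX : IsPowTorsion I X) : IsPowTorsion J X := by
  obtain ⟨k, hk⟩ := Ideal.exists_pow_le_of_le_radical_of_fg hJI hJ
  intro x
  obtain ⟨s, hs⟩ := hX x
  refine ⟨k * s, fun r hr => hs r (Ideal.pow_right_mono hk s ?_)⟩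
  rwa [← pow_mul]

omit [IsNoetherianRing R] in
lemma span_cons_sup (I : Ideal R) (l : List R) :
    I ⊔ Ideal.span {x | x ∈ θ :: l} = (I ⊔ Ideal.span {θ}) ⊔ Ideal.span {x | x ∈ l} := by
  have hset : ({x | x ∈ θ :: l} : Set R) = insert θ {x | x ∈ l} := by ext; simp
  rw [hset, Ideal.span_insert, sup_assoc]

/-- Local cohomology vanishes above the number of generators of `J` up to radical, modulo an
ideal whose powers kill the elements of the module. -/
theorem van_of_length_lt (l : List R) (hl : ∀ x ∈ l, x ∈ J) (I : Ideal R)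
    (hJ : J ≤ (I ⊔ Ideal.span {x | x ∈ l}).radical) (X : Type u) [AddCommGroup X] [Module R X]
    (hX : IsPowTorsion I X) (i : ℕ) (hi : l.length < i) : Van J i X := by
  induction l generalizing I X i with
  | nil =>
    obtain ⟨i, rfl⟩ : ∃ k, i = k + 1 := ⟨i - 1, by simp at hi; omega⟩
    exact (hX.of_le_radical (IsNoetherian.noetherian J) (by simpa using hJ)).van i
  | cons θ l ih =>
    rw [span_cons_sup] at hJ
    have hl' : ∀ x ∈ l, x ∈ J := fun x hx => hl x (List.mem_cons_of_mem _ hx)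
    simp only [List.length_cons] at hi
    obtain ⟨i, rfl⟩ : ∃ k, i = k + 1 := ⟨i - 1, by omega⟩
    -- The kernel and cokernel of `X → X_θ` are torsion for `I ⊔ (θ)`, hence need only the
    -- parameters in `l`, while `X_θ` has no local cohomology at all. Splitting at the image of `X`
    -- gives two short exact sequences.
    have hK := ih hl' _ hJ _ (isPowTorsion_ker_toAway (θ := θ) hX) (i + 1) (by omega)
    have hC := ih hl' _ hJ _ (isPowTorsion_awayCoker (θ := θ) hX) i (by omega)
    have hB : Van J (i + 1) (Away θ X) := van_of_bijective (hl θ List.mem_cons_self)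
      bijective_smul_away
    have hR : Van J (i + 1) (LinearMap.range (toAway θ X)) :=
      Van.left (Submodule.subtype_injective _) (LinearMap.exact_subtype_mkQ _)
        (Submodule.mkQ_surjective _) hB hC
    exact Van.middle (f := (LinearMap.ker (toAway θ X)).subtype) (g := (toAway θ X).rangeRestrict)
      (Submodule.subtype_injective _)
      (LinearMap.exact_iff.2 (by simp)) (LinearMap.surjective_rangeRestrict _) hK hR

/-- If the top local cohomology vanishes, then so does `colim X / (θ₁ᵗ, …, θₐᵗ) X`. -/
theorem exists_prod_pow_smul_mem (l : List R) (hl : ∀ x ∈ l, x ∈ J) (I : Ideal R)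
    (hJ : J ≤ (I ⊔ Ideal.span {x | x ∈ l}).radical) (X : Type u) [AddCommGroup X] [Module R X]
    (hX : IsPowTorsion I X) (hV : Van J l.length X) (x : X) (t : ℕ) :
    ∃ s : ℕ, l.prod ^ s • x ∈ Ideal.span ((· ^ (t + s)) '' {y | y ∈ l}) • (⊤ : Submodule R X) := by
  induction l generalizing I X t with
  | nil =>
    obtain ⟨s, hs⟩ := hX.of_le_radical (IsNoetherian.noetherian J) (by simpa using hJ) x
    rw [eq_zero_of_van_zero hV s x hs]
    exact ⟨0, by simp⟩
  | cons θ l ih =>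
    rw [span_cons_sup] at hJ
    have hl' : ∀ x ∈ l, x ∈ J := fun x hx => hl x (List.mem_cons_of_mem _ hx)
    have hK := van_of_length_lt l hl' _ hJ _ (isPowTorsion_ker_toAway (θ := θ) hX)
      (l.length + 1 + 1) (by omega)
    have hR : Van J (l.length + 1) (LinearMap.range (toAway θ X)) :=
      Van.right (f := (LinearMap.ker (toAway θ X)).subtype) (g := (toAway θ X).rangeRestrict)
        (Submodule.subtype_injective _)
        (LinearMap.exact_iff.2 (by simp)) (LinearMap.surjective_rangeRestrict _) hV hK
    have hB : Van J l.length (Away θ X) := van_of_bijective (hl θ List.mem_cons_self)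
      bijective_smul_away
    have hC : Van J l.length (AwayCoker θ X) :=
      Van.right (Submodule.subtype_injective _) (LinearMap.exact_subtype_mkQ _)
        (Submodule.mkQ_surjective _) hB hR
    -- `z` is the fraction `x / θ ^ t`; the induction hypothesis is applied to its class in `X_θ /
    -- X`.
    obtain ⟨z, hz⟩ := (bijective_smul_away (θ := θ) (X := X)).2.iterate t (toAway θ X x)
    rw [smul_iterate] at hz
    obtain ⟨s, hs⟩ := ih hl' _ hJ _ (isPowTorsion_awayCoker (θ := θ) hX) hC
      (Submodule.mkQ _ z) t
    have htop : (⊤ : Submodule R (AwayCoker θ X)) =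
        (⊤ : Submodule R (Away θ X)).map (Submodule.mkQ _) := by
      rw [Submodule.map_top, Submodule.range_mkQ]
    rw [← map_smul, htop, ← Submodule.map_smul''] at hs
    obtain ⟨w, hw, hwz⟩ := hs
    obtain ⟨x₀, hx₀⟩ : ∃ x₀, toAway θ X x₀ = l.prod ^ s • z - w := by
      rw [← LinearMap.mem_range, ← Submodule.Quotient.mk_eq_zero, Submodule.Quotient.mk_sub]
      exact sub_eq_zero.2 hwz.symm
    obtain ⟨k, x', hx', hk⟩ := exists_pow_smul_mem_of_mem_smul_top _ hw
    obtain ⟨k', hk'⟩ := exists_pow_smul_eq_of_toAway_eq (θ := θ)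
      (x := (θ ^ k * l.prod ^ s) • x) (y := θ ^ t • x' + (θ ^ (k + t)) • x₀) (by
        rw [map_add, map_smul, map_smul, map_smul, ← hz, ← hk, hx₀]
        module)
    -- After clearing denominators, `θ ^ k' * θ ^ k * l.prod ^ s` multiplies `x`. The further factor
    -- `θ ^ s * l.prod ^ (k' + k)` brings `θ` and `l.prod` to the common exponent `k' + k + s`.
    refine ⟨k' + k + s, ?_⟩
    have key : (θ :: l).prod ^ (k' + k + s) • x =
        θ ^ (s + k' + t) • l.prod ^ (k' + k) • x' +
          θ ^ (t + (k' + k + s)) • l.prod ^ (k' + k) • x₀ := by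
      have h1 := congrArg (fun u => (θ ^ s * l.prod ^ (k' + k)) • u) hk'
      simp only [smul_add, smul_smul] at h1
      have e₁ : (θ :: l).prod ^ (k' + k + s) =
          θ ^ s * l.prod ^ (k' + k) * (θ ^ k' * (θ ^ k * l.prod ^ s)) := by
        rw [List.prod_cons]; ring
      have e₂ : θ ^ (s + k' + t) * l.prod ^ (k' + k) =
          θ ^ s * l.prod ^ (k' + k) * (θ ^ k' * θ ^ t) := by ring
      have e₃ : θ ^ (t + (k' + k + s)) * l.prod ^ (k' + k) =
          θ ^ s * l.prod ^ (k' + k) * (θ ^ k' * θ ^ (k + t)) := by ring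
      rw [smul_smul, smul_smul, e₁, e₂, e₃, h1]
    rw [key]
    refine Submodule.add_mem _ (Submodule.smul_mem _ _ ?_) (Submodule.smul_mem_smul
      (Ideal.subset_span ⟨θ, List.mem_cons_self, rfl⟩) trivial)
    have h2 := prod_pow_smul_mem l (k' + k) hx'
    rw [show t + s + (k' + k) = t + (k' + k + s) by ring] at h2
    exact Submodule.smul_mono_left (Ideal.span_mono (Set.image_mono fun y hy =>
      List.mem_cons_of_mem _ hy)) h2

end LocalizationCokernel
-- Completing a form to a system of parameters, over any field
section HomogeneousParameters

open MvPolynomial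

variable {K : Type u} [Field K]

lemma eval_map_finSuccEquiv {A : Type u} [CommRing A] [Algebra K A] {b : ℕ} (z : Fin (b + 1) → A)
    (F : MvPolynomial (Fin (b + 1)) K) :
    ((finSuccEquiv K b F).map (aeval (Fin.tail z)).toRingHom).eval (z 0) = aeval z F := by
  induction F using MvPolynomial.induction_on with
  | C a => simp [finSuccEquiv_apply]
  | add p q hp hq => rw [map_add, Polynomial.map_add, Polynomial.eval_add, hp, hq, map_add]
  | mul_X p i hp =>
    rw [map_mul, Polynomial.map_mul, Polynomial.eval_mul, hp, map_mul]
    congr 1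
    refine Fin.cases ?_ (fun i => ?_) i
    · simp [finSuccEquiv_X_zero]
    · simp [finSuccEquiv_X_succ, Fin.tail]

/-- A polynomial system of one-variable equations that avoids the zeros of a given `F ≠ 0`. -/
lemma exists_monic_forall_aeval_ne_zero : ∀ {b : ℕ} (F : MvPolynomial (Fin b) K), F ≠ 0 →
    ∃ m : Fin b → Polynomial K, (∀ i, (m i).Monic ∧ 0 < (m i).natDegree) ∧
      ∀ z : Fin b → AlgebraicClosure K, (∀ i, Polynomial.aeval (z i) (m i) = 0) →
        aeval z F ≠ 0 := by
  intro b
  induction b with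
  | zero =>
    intro F hF
    refine ⟨Fin.elim0, fun i => i.elim0, fun z _ h => hF ?_⟩
    obtain ⟨c, rfl⟩ := C_surjective (Fin 0) F
    rw [aeval_C, map_eq_zero] at h
    rw [h, map_zero]
  | succ b ih =>
    intro F hF
    let G := finSuccEquiv K b F
    have hG : G ≠ 0 := by simpa [G] using hF
    obtain ⟨m, hm, hmz⟩ := ih G.leadingCoeff (Polynomial.leadingCoeff_ne_zero.2 hG)
    let Z : Set (Fin b → AlgebraicClosure K) := {z | ∀ i, Polynomial.aeval (z i) (m i) = 0}
    have hZ : Z.Finite := by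
      have : Z ⊆ Set.pi Set.univ fun i => (m i).rootSet (AlgebraicClosure K) := by
        intro z hz i _
        exact Polynomial.mem_rootSet.2 ⟨(hm i).1.ne_zero, hz i⟩
      exact (Set.Finite.pi' fun i => Polynomial.rootSet_finite _ _).subset
        fun z hz i => this hz i trivial
    let Gz (z : Fin b → AlgebraicClosure K) : Polynomial (AlgebraicClosure K) :=
      G.map (aeval z).toRingHom
    have hGz : ∀ z ∈ Z, Gz z ≠ 0 := fun z hz h => hmz z hz (by
      have := congrArg (fun p => p.coeff G.natDegree) h
      simpa [Gz, Polynomial.coeff_map] using this)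
    have hB : (⋃ z ∈ Z, {x | (Gz z).IsRoot x}).Finite :=
      hZ.biUnion fun z hz => Polynomial.finite_setOfPred_isRoot (hGz z hz)
    -- Over the finitely many common zeros `z` of the other equations, `F` has finitely many roots
    -- in the remaining coordinate. `m₀` takes the value `1` at each of them; the factor `X` keeps
    -- the degree positive when there are none.
    let m₀ : Polynomial K := Polynomial.X * ∏ β ∈ hB.toFinset, minpoly K β + 1
    have hmon : (∏ β ∈ hB.toFinset, minpoly K β).Monic :=
      Polynomial.monic_prod_of_monic _ _ fun β _ =>
        minpoly.monic (Algebra.IsIntegral.isIntegral β)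
    have hmon' := Polynomial.monic_X.mul hmon
    have hdeg : 0 < (Polynomial.X * ∏ β ∈ hB.toFinset, minpoly K β).natDegree := by
      rw [Polynomial.natDegree_X_mul hmon.ne_zero]; omega
    refine ⟨Fin.cons m₀ m, ?_, ?_⟩
    · refine Fin.cases ⟨?_, ?_⟩ fun i => by simpa using hm i
      · refine hmon'.add_of_left ?_
        rw [Polynomial.degree_one, ← Polynomial.natDegree_pos_iff_degree_pos]
        exact hdeg
      · simp only [Fin.cons_zero, m₀]
        rw [← Polynomial.C_1, Polynomial.natDegree_add_C]
        exact hdeg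
    · intro z hz hF0
      have hzZ : Fin.tail z ∈ Z := fun i => by simpa [Fin.tail] using hz i.succ
      have h0 := hz 0
      rw [Fin.cons_zero] at h0
      have hroot : (Gz (Fin.tail z)).IsRoot (z 0) :=
        (eval_map_finSuccEquiv z F).trans hF0
      have hmem : z 0 ∈ hB.toFinset := by
        rw [Set.Finite.mem_toFinset, Set.mem_iUnion₂]
        exact ⟨_, hzZ, hroot⟩
      have hprod : Polynomial.aeval (z 0) (∏ β ∈ hB.toFinset, minpoly K β) = 0 := by
        rw [map_prod]
        exact Finset.prod_eq_zero hmem (minpoly.aeval K _)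
      rw [map_add, map_mul, hprod, mul_zero, zero_add, map_one] at h0
      exact one_ne_zero h0

/-- Replacing each `m i` by a suitable power equalizes the degrees and does not change the zeros. -/
lemma exists_monic_natDegree_eq_forall_aeval_ne_zero {b : ℕ} (F : MvPolynomial (Fin b) K)
    (hF : F ≠ 0) : ∃ (D : ℕ) (m : Fin b → Polynomial K), 0 < D ∧
      (∀ i, (m i).Monic ∧ (m i).natDegree = D) ∧
      ∀ z : Fin b → AlgebraicClosure K, (∀ i, Polynomial.aeval (z i) (m i) = 0) →
        aeval z F ≠ 0 := by
  obtain ⟨m, hm, hz⟩ := exists_monic_forall_aeval_ne_zero F hF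
  refine ⟨∏ i, (m i).natDegree, fun i => m i ^ ((∏ i, (m i).natDegree) / (m i).natDegree),
    Finset.prod_pos fun i _ => (hm i).2, fun i => ⟨(hm i).1.pow _, ?_⟩, fun z h => hz z fun i => ?_⟩
  · rw [(hm i).1.natDegree_pow, Nat.div_mul_cancel (Finset.dvd_prod_of_mem _ (Finset.mem_univ i))]
  · have := h i
    rw [map_pow] at this
    exact (pow_eq_zero_iff (Nat.div_pos (Nat.le_of_dvd (Finset.prod_pos fun i _ => (hm i).2)
      (Finset.dvd_prod_of_mem _ (Finset.mem_univ i))) (hm i).2).ne').1 this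

/-- In a form the exponent of `X 0` is determined by the other exponents, so setting `X 0 = 1`
causes no cancellation. -/
lemma aeval_cons_one_ne_zero {b d : ℕ} {f : MvPolynomial (Fin (b + 1)) K} (hf : f.IsHomogeneous d)
    (hf0 : f ≠ 0) : aeval (Fin.cons 1 X : Fin (b + 1) → MvPolynomial (Fin b) K) f ≠ 0 := by
  have hG : aeval (Fin.cons 1 X : Fin (b + 1) → MvPolynomial (Fin b) K) f =
      (finSuccEquiv K b f).eval 1 := by
    rw [← eval_map_finSuccEquiv]
    have : (aeval (Fin.tail (Fin.cons 1 X : Fin (b + 1) → MvPolynomial (Fin b) K))).toRingHom =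
        RingHom.id (MvPolynomial (Fin b) K) := by
      rw [Fin.tail_cons, aeval_X_left]
      rfl
    rw [this, Polynomial.map_id, Fin.cons_zero]
  obtain ⟨u, hu⟩ := exists_coeff_ne_zero hf0
  intro h0
  have h1 := congrArg (coeff (Finsupp.tail u)) (hG.symm.trans h0)
  rw [Polynomial.eval_eq_sum_range, coeff_sum, Finset.sum_eq_single (u 0)] at h1
  · rw [one_pow, mul_one, finSuccEquiv_coeff_coeff, Finsupp.cons_tail] at h1
    exact hu h1
  · intro k _ hk
    rw [one_pow, mul_one, finSuccEquiv_coeff_coeff]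
    by_contra hc
    have e₁ := hf hu
    have e₂ := hf hc
    rw [← e₁] at e₂
    simp only [Finsupp.weight_apply, Pi.one_apply, smul_eq_mul, mul_one] at e₂
    rw [Finsupp.sum_fintype _ _ (by simp), Finsupp.sum_fintype _ _ (by simp), Fin.sum_univ_succ,
      Fin.sum_univ_succ] at e₂
    simp only [Finsupp.cons_zero, Finsupp.cons_succ, Finsupp.tail_apply] at e₂
    omega
  · intro hk
    rw [Polynomial.coeff_eq_zero_of_natDegree_lt (by simpa using hk)]
    simp

lemma IsHomogeneous.aeval_mul_eq {σ A : Type*} [CommRing A] [Algebra K A] {d : ℕ}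
    {f : MvPolynomial σ K} (hf : f.IsHomogeneous d) (c : A) (w : σ → A) :
    MvPolynomial.aeval (fun j => c * w j) f = c ^ d * MvPolynomial.aeval w f := by
  rw [aeval_def, aeval_def, eval₂_eq, eval₂_eq, Finset.mul_sum]
  refine Finset.sum_congr rfl fun u hu => ?_
  have hd : ∑ i ∈ u.support, u i = d := by
    have := hf (mem_support_iff.1 hu)
    simpa [Finsupp.weight_apply, Finsupp.sum] using this
  simp only [mul_pow]
  rw [Finset.prod_mul_distrib, Finset.prod_pow_eq_pow_sum, hd]
  ring

/-- The homogenization of `m` with respect to the variables `X i` and `X 0`. -/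
noncomputable def homogenizeAt {b : ℕ} (m : Polynomial K) (i : Fin (b + 1)) :
    MvPolynomial (Fin (b + 1)) K :=
  ∑ k ∈ Finset.range (m.natDegree + 1), C (m.coeff k) * X i ^ k * X 0 ^ (m.natDegree - k)

lemma isHomogeneous_homogenizeAt {b : ℕ} (m : Polynomial K) (i : Fin (b + 1)) :
    (homogenizeAt m i).IsHomogeneous m.natDegree := by
  refine IsHomogeneous.sum _ _ _ fun k hk => ?_
  have := ((isHomogeneous_C (Fin (b + 1)) (m.coeff k)).mul (isHomogeneous_X_pow i k)).mul
    (isHomogeneous_X_pow (R := K) (0 : Fin (b + 1)) (m.natDegree - k))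
  rw [Finset.mem_range] at hk
  rwa [show 0 + k + (m.natDegree - k) = m.natDegree by omega] at this

/-- If `f ≠ 0` is a form in `b + 1` variables, there are `b` forms of the same positive degree that
generate with `f` an ideal with radical containing the variables. -/
theorem exists_forms_radical {b d : ℕ} {f : MvPolynomial (Fin (b + 1)) K} (hf : f.IsHomogeneous d)
    (hf0 : f ≠ 0) : ∃ (D : ℕ) (η : Fin b → MvPolynomial (Fin (b + 1)) K), 0 < D ∧
      (∀ i, (η i).IsHomogeneous D) ∧
      ∀ j, X j ∈ (Ideal.span {f} ⊔ Ideal.span (Set.range η)).radical := by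
  obtain ⟨D, m, hD, hm, hmz⟩ :=
    exists_monic_natDegree_eq_forall_aeval_ne_zero _ (aeval_cons_one_ne_zero hf hf0)
  refine ⟨D, fun i => homogenizeAt (m i) i.succ, hD,
    fun i => (hm i).2 ▸ isHomogeneous_homogenizeAt (m i) i.succ, fun j => ?_⟩
  -- By the Nullstellensatz it suffices that the only common zero over the algebraic closure is the
  -- origin.
  rw [← vanishingIdeal_zeroLocus_eq_radical (K := AlgebraicClosure K), mem_vanishingIdeal_iff]
  intro w hw
  rw [mem_zeroLocus_iff] at hw
  have hwf : aeval w f = 0 := hw f (Ideal.mem_sup_left (Ideal.mem_span_singleton_self f))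
  have hwη : ∀ i, ∑ k ∈ Finset.range (D + 1),
      algebraMap K (AlgebraicClosure K) ((m i).coeff k) * w i.succ ^ k * w 0 ^ (D - k) = 0 := by
    intro i
    have := hw _ (Ideal.mem_sup_right (Ideal.subset_span ⟨i, rfl⟩))
    simpa [homogenizeAt, (hm i).2] using this
  have hlead : ∀ i, (m i).coeff D = 1 := fun i => by
    rw [← (hm i).2]; exact (hm i).1
  -- At `w 0 = 0` only the leading terms `w i ^ D` survive. If `w 0 ≠ 0`, rescaling to `w 0 = 1`
  -- gives a common zero of the `m i` and of the dehomogenized `f`, which was excluded.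
  by_cases h0 : w 0 = 0
  · suffices ∀ j, w j = 0 by simpa using this j
    refine Fin.cases h0 fun i => ?_
    have := hwη i
    rw [Finset.sum_range_succ, Finset.sum_eq_zero, zero_add, hlead] at this
    · simpa [hD.ne'] using this
    · intro k hk
      rw [Finset.mem_range] at hk
      simp [h0, show D - k ≠ 0 by omega]
  · exfalso
    refine hmz (fun i => w i.succ / w 0) (fun i => ?_) ?_
    · have h1 := hwη i
      rw [Polynomial.aeval_eq_sum_range, (hm i).2]
      have h2 : w 0 ^ D * ∑ k ∈ Finset.range (D + 1), (m i).coeff k • (w i.succ / w 0) ^ k = 0 := by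
        rw [← h1, Finset.mul_sum]
        refine Finset.sum_congr rfl fun k hk => ?_
        rw [Finset.mem_range] at hk
        have h3 : w 0 ^ D = w 0 ^ k * w 0 ^ (D - k) := by rw [← pow_add]; congr 1; omega
        rw [h3, Algebra.smul_def, div_pow]
        field_simp
      exact (mul_eq_zero.1 h2).resolve_left (pow_ne_zero _ h0)
    · have h1 : aeval (fun i => w i.succ / w 0)
          (aeval (Fin.cons 1 X : Fin (b + 1) → MvPolynomial (Fin b) K) f) =
          aeval (fun j => (w 0)⁻¹ * w j) f := by
        rw [← AlgHom.comp_apply]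
        congr 1
        ext j
        refine Fin.cases ?_ (fun i => ?_) j
        · simp [h0]
        · simp [div_eq_inv_mul]
      rw [h1]
      rw [IsHomogeneous.aeval_mul_eq hf, hwf, mul_zero]

end HomogeneousParameters
-- Bigraded modules and graded Nakayama lemmas
section BigradedProjections

open MvPolynomial

variable (K : Type u) [Field K] (m n : ℕ)

/-- The projections of a bigraded module onto its components. -/
structure BigradedProj (M : Type u) [AddCommGroup M] [Module (PolyRing K m n) M] where
  π : ℤ × ℤ → M →+ M
  π_C : ∀ d (a : K) x, π d ((C a : PolyRing K m n) • x) = (C a : PolyRing K m n) • π d x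
  π_X : ∀ d v x, π d ((X v : PolyRing K m n) • x) = (X v : PolyRing K m n) • π (d - varDegree m n v) x
  exists_sum : ∀ x, ∃ s : Finset (ℤ × ℤ), x = ∑ d ∈ s, π d x
  π_π : ∀ d x, π d (π d x) = π d x
  π_π_ne : ∀ d d' x, d ≠ d' → π d (π d' x) = 0

/-- The ideal `(x₁, …, xₘ)`. -/
noncomputable def idealP : Ideal (PolyRing K m n) :=
  Ideal.span (Set.range fun i : Fin m => X (Sum.inl i))

variable {K m n} {M : Type u} [AddCommGroup M] [Module (PolyRing K m n) M]

lemma smul_closed_of_C_of_X {p : M → Prop} (hadd : ∀ x y, p x → p y → p (x + y))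
    (hC : ∀ (a : K) x, p x → p ((C a : PolyRing K m n) • x))
    (hX : ∀ v x, p x → p ((X v : PolyRing K m n) • x)) (r : PolyRing K m n) {x : M} (hx : p x) :
    p (r • x) := by
  induction r using MvPolynomial.induction_on generalizing x with
  | C a => exact hC a x hx
  | add r s hr hs => rw [add_smul]; exact hadd _ _ (hr hx) (hs hx)
  | mul_X r v hr => rw [mul_smul]; exact hr (hX v x hx)

lemma smul_top_induction {R X ι : Type*} [CommRing R] [AddCommGroup X] [Module R X] {v : ι → R}
    {p : X → Prop} (h0 : p 0) (hadd : ∀ x y, p x → p y → p (x + y)) (hv : ∀ i x, p (v i • x))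
    {x : X} (hx : x ∈ Ideal.span (Set.range v) • (⊤ : Submodule R X)) : p x := by
  induction hx using Submodule.smul_induction_on' with
  | smul r hr x _ =>
    induction hr using Submodule.span_induction generalizing x with
    | mem r hr => obtain ⟨i, rfl⟩ := hr; exact hv i x
    | zero => rw [zero_smul]; exact h0
    | add r s _ _ hr hs => rw [add_smul]; exact hadd _ _ (hr x trivial) (hs x trivial)
    | smul c r _ hr => rw [smul_assoc, smul_comm]; exact hr _ trivial
  | add x _ y _ hx hy => exact hadd _ _ hx hy

namespace BigradedProj

variable (G : BigradedProj K m n M)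

lemma π_monomial (d : ℤ × ℤ) (s : Fin m ⊕ Fin n →₀ ℕ) (a : K) (x : M) :
    G.π d ((monomial s a : PolyRing K m n) • x) =
      (monomial s a : PolyRing K m n) • G.π (d - Finsupp.weight (varDegree m n) s) x := by
  induction s using Finsupp.induction_linear generalizing d a x with
  | zero => simpa using G.π_C d a x
  | add s t hs ht =>
    have : (monomial (s + t) a : PolyRing K m n) = monomial s a * monomial t 1 := by
      rw [monomial_mul, mul_one]
    rw [this, mul_smul, hs, ht, mul_smul, map_add, sub_sub]
  | single v k =>
    induction k generalizing d a x with
    | zero => simpa using G.π_C d a x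
    | succ k ih =>
      have : (monomial (Finsupp.single v (k + 1)) a : PolyRing K m n) =
          X v * monomial (Finsupp.single v k) a := by
        rw [X, monomial_mul, one_mul, ← Finsupp.single_add, add_comm]
      rw [this, mul_smul, G.π_X, ih, mul_smul, Finsupp.single_add, map_add, sub_sub,
        add_comm (varDegree m n v)]
      simp [Finsupp.weight_single]

lemma π_smul_of_isWeightedHomogeneous {r : PolyRing K m n} {δ : ℤ × ℤ}
    (hr : IsWeightedHomogeneous (varDegree m n) r δ) (d : ℤ × ℤ) (x : M) :
    G.π d (r • x) = r • G.π (d - δ) x := by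
  conv_lhs => rw [r.as_sum]
  conv_rhs => rw [r.as_sum]
  rw [Finset.sum_smul, Finset.sum_smul, map_sum]
  refine Finset.sum_congr rfl fun s hs => ?_
  rw [G.π_monomial, hr (mem_support_iff.1 hs)]

/-- `L` contains the homogeneous components of its elements. -/
def IsHomog (L : Submodule (PolyRing K m n) M) : Prop := ∀ d, ∀ x ∈ L, G.π d x ∈ L

variable {G}

lemma mem_of_forall_π {L : Submodule (PolyRing K m n) M} {x : M} (h : ∀ d, G.π d x ∈ L) : x ∈ L := by
  obtain ⟨s, hs⟩ := G.exists_sum x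
  rw [hs]
  exact L.sum_mem fun d _ => h d

lemma exists_finset_π_eq_zero (x : M) : ∃ s : Finset (ℤ × ℤ), ∀ d ∉ s, G.π d x = 0 := by
  obtain ⟨s, hs⟩ := G.exists_sum x
  refine ⟨s, fun d hd => ?_⟩
  rw [hs, map_sum]
  exact Finset.sum_eq_zero fun d' hd' => G.π_π_ne _ _ _ fun h => hd (h ▸ hd')

lemma IsHomog.span_smul_top {ι : Type*} {v : ι → PolyRing K m n} {δ : ι → ℤ × ℤ}
    (hv : ∀ i, IsWeightedHomogeneous (varDegree m n) (v i) (δ i)) :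
    G.IsHomog (Ideal.span (Set.range v) • ⊤) := by
  intro d x hx
  refine smul_top_induction (p := fun x => G.π d x ∈ Ideal.span (Set.range v) • ⊤) ?_ ?_ ?_ hx
  · rw [map_zero]; exact Submodule.zero_mem _
  · intro x y hx hy; rw [map_add]; exact Submodule.add_mem _ hx hy
  · intro i x
    rw [G.π_smul_of_isWeightedHomogeneous (hv i)]
    exact Submodule.smul_mem_smul (Ideal.subset_span ⟨i, rfl⟩) trivial

/-- The elements whose components of `ℓ`-degree below `j` lie in `L`. -/
def below (G : BigradedProj K m n M) (ℓ : ℤ × ℤ →+ ℤ) (hℓ : ∀ v, 0 ≤ ℓ (varDegree m n v))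
    (L : Submodule (PolyRing K m n) M) (j : ℤ) : Submodule (PolyRing K m n) M where
  carrier := {x | ∀ d, ℓ d < j → G.π d x ∈ L}
  zero_mem' := fun d _ => by rw [map_zero]; exact L.zero_mem
  add_mem' := fun hx hy d hd => by rw [map_add]; exact L.add_mem (hx d hd) (hy d hd)
  smul_mem' := by
    intro r x hx
    refine smul_closed_of_C_of_X (p := fun x => ∀ d, ℓ d < j → G.π d x ∈ L) ?_ ?_ ?_ r hx
    · exact fun x y hx hy d hd => by rw [map_add]; exact L.add_mem (hx d hd) (hy d hd)
    · exact fun a x hx d hd => by rw [G.π_C]; exact L.smul_mem _ (hx d hd)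
    · intro v x hx d hd
      rw [G.π_X]
      refine L.smul_mem _ (hx _ ?_)
      have := hℓ v
      rw [map_sub]
      omega

section Below

variable {ℓ : ℤ × ℤ →+ ℤ} {hℓ : ∀ v, 0 ≤ ℓ (varDegree m n v)} {L : Submodule (PolyRing K m n) M}

lemma span_smul_le_below {ι : Type*} {σ : ι → Fin m ⊕ Fin n}
    (hσ : ∀ i, 1 ≤ ℓ (varDegree m n (σ i))) {j : ℤ} {N : Submodule (PolyRing K m n) M}
    (hN : N ≤ G.below ℓ hℓ L j) :
    Ideal.span (Set.range fun i => (X (σ i) : PolyRing K m n)) • N ≤ G.below ℓ hℓ L (j + 1) := by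
  rw [Submodule.smul_le]
  intro r hr x hx
  induction hr using Submodule.span_induction with
  | mem r hr =>
    obtain ⟨i, rfl⟩ := hr
    intro d hd
    rw [G.π_X]
    refine L.smul_mem _ (hN hx _ ?_)
    have := hσ i
    rw [map_sub]
    omega
  | zero => rw [zero_smul]; exact Submodule.zero_mem _
  | add r s _ _ hr hs => rw [add_smul]; exact Submodule.add_mem _ hr hs
  | smul c r _ hr => rw [smul_assoc]; exact Submodule.smul_mem _ _ hr

lemma mem_of_forall_mem_below {x : M} (h : ∀ j, x ∈ G.below ℓ hℓ L j) : x ∈ L :=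
  mem_of_forall_π fun d => h (ℓ d + 1) d (by omega)

/-- Finitely many generators have finitely many components, and the variables do not lower `ℓ`:
degrees are bounded below. This is the starting point of the Nakayama arguments that follow. -/
lemma exists_below_eq_top [Module.Finite (PolyRing K m n) M] : ∃ c, G.below ℓ hℓ L c = ⊤ := by
  have h1 : ∀ x : M, ∃ c, x ∈ G.below ℓ hℓ L c := by
    intro x
    obtain ⟨s, hs⟩ := exists_finset_π_eq_zero (G := G) x
    obtain ⟨c, hc⟩ := (s.image ℓ).bddBelow
    refine ⟨c, fun d hd => ?_⟩
    rw [hs d fun h => absurd (hc (Finset.mem_coe.2 (Finset.mem_image_of_mem ℓ h))) (by omega)]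
    exact L.zero_mem
  choose c hc using h1
  obtain ⟨S, hS⟩ := Module.Finite.fg_top (R := PolyRing K m n) (M := M)
  obtain ⟨c₀, hc₀⟩ := (S.image c).bddBelow
  refine ⟨c₀, eq_top_iff.2 (hS ▸ Submodule.span_le.2 fun x hx d hd => hc x d ?_)⟩
  exact hd.trans_le (hc₀ (Finset.mem_coe.2 (Finset.mem_image_of_mem c hx)))

end Below

/-- The `y`-degree and the `x`-degree are nonnegative on variables. -/
lemma snd_varDegree_nonneg (v : Fin m ⊕ Fin n) :
    0 ≤ AddMonoidHom.snd ℤ ℤ (varDegree m n v) := by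
  rcases v with i | j <;> simp [varDegree]

lemma fst_varDegree_nonneg (v : Fin m ⊕ Fin n) :
    0 ≤ AddMonoidHom.fst ℤ ℤ (varDegree m n v) := by
  rcases v with i | j <;> simp [varDegree]

variable (G) in
abbrev belowY (L : Submodule (PolyRing K m n) M) (j : ℤ) : Submodule (PolyRing K m n) M :=
  G.below (AddMonoidHom.snd ℤ ℤ) snd_varDegree_nonneg L j

variable (G) in
abbrev belowX (L : Submodule (PolyRing K m n) M) (j : ℤ) : Submodule (PolyRing K m n) M :=
  G.below (AddMonoidHom.fst ℤ ℤ) fst_varDegree_nonneg L j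

lemma idealQ_smul_le_belowY {L N : Submodule (PolyRing K m n) M} {j : ℤ} (hN : N ≤ G.belowY L j) :
    idealQ K m n • N ≤ G.belowY L (j + 1) :=
  span_smul_le_below (σ := Sum.inr) (fun i => by simp [varDegree]) hN

lemma idealP_smul_le_belowX {L N : Submodule (PolyRing K m n) M} {j : ℤ} (hN : N ≤ G.belowX L j) :
    idealP K m n • N ≤ G.belowX L (j + 1) :=
  span_smul_le_below (σ := Sum.inl) (fun i => by simp [varDegree]) hN

variable [Module.Finite (PolyRing K m n) M]

/-- Elements of `1 + Q` act injectively modulo homogeneous submodules. -/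
lemma mem_of_one_sub_smul_mem {L : Submodule (PolyRing K m n) M} (hL : G.IsHomog L)
    {r : PolyRing K m n} (hr : r ∈ idealQ K m n) {x : M} (hx : (1 - r) • x ∈ L) : x ∈ L := by
  obtain ⟨c, hc⟩ := exists_below_eq_top (G := G) (ℓ := AddMonoidHom.snd ℤ ℤ)
    (hℓ := snd_varDegree_nonneg) (L := L)
  -- From `x = (1 - r) x + r x`: the first term has all components in `L`, and `r ∈ Q` raises the
  -- bound by one each time.
  have key : ∀ k : ℕ, x ∈ G.belowY L (c + k) := by
    intro k
    induction k with
    | zero => rw [Nat.cast_zero, add_zero, belowY, hc]; trivial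
    | succ k ih =>
      have h1 : r • x ∈ G.belowY L (c + k + 1) :=
        idealQ_smul_le_belowY le_rfl (Submodule.smul_mem_smul hr ih)
      have h2 : (1 - r) • x ∈ G.belowY L (c + k + 1) := fun d _ => hL d _ hx
      have h3 := Submodule.add_mem _ h2 h1
      rw [← add_smul, sub_add_cancel, one_smul] at h3
      convert h3 using 2
      push_cast; ring
  refine mem_of_forall_mem_below (G := G) (hℓ := snd_varDegree_nonneg) fun j => ?_
  intro d hd
  refine key (j - c).toNat d ?_
  have := Int.self_le_toNat (j - c)
  omega

/-- The graded Nakayama lemma for `P`. -/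
lemma subsingleton_of_idealP_smul_top (h : idealP K m n • (⊤ : Submodule (PolyRing K m n) M) = ⊤)
    (G : BigradedProj K m n M) : Subsingleton M := by
  obtain ⟨c, hc⟩ := exists_below_eq_top (G := G) (ℓ := AddMonoidHom.fst ℤ ℤ)
    (hℓ := fst_varDegree_nonneg) (L := ⊥)
  have key : ∀ k : ℕ, G.belowX ⊥ (c + k) = ⊤ := by
    intro k
    induction k with
    | zero => rw [Nat.cast_zero, add_zero, belowX, hc]
    | succ k ih =>
      rw [eq_top_iff, ← h]
      refine (idealP_smul_le_belowX ih.ge).trans (le_of_eq ?_)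
      congr 1
      push_cast; ring
  refine subsingleton_of_forall_eq 0 fun x => ?_
  rw [← Submodule.mem_bot (PolyRing K m n)]
  refine mem_of_forall_mem_below (G := G) (hℓ := fst_varDegree_nonneg) fun j => ?_
  intro d hd
  have hx : x ∈ G.belowX ⊥ (c + (j - c).toNat) := by rw [key]; trivial
  refine hx d ?_
  have := Int.self_le_toNat (j - c)
  omega

variable (G) in
-- Let `D` bound the `y`-degrees of the components of the generators. Multiplication by
-- `x`-variables does not change the `y`-degree, so `y`-degree at least `D + s` is reached only
-- through at least `s` factors `yⱼ` (for `s = 0` there is nothing to prove).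
lemma exists_forall_π_mem_pow : ∃ D : ℤ, ∀ (s : ℕ) (x : M) (d : ℤ × ℤ), D + s ≤ d.2 →
    G.π d x ∈ idealQ K m n ^ s • (⊤ : Submodule (PolyRing K m n) M) := by
  have h1 : ∀ x : M, ∃ c : ℤ, ∀ d : ℤ × ℤ, c < d.2 → G.π d x = 0 := by
    intro x
    obtain ⟨s, hs⟩ := exists_finset_π_eq_zero (G := G) x
    obtain ⟨c, hc⟩ := (s.image Prod.snd).exists_le
    exact ⟨c, fun d hd => hs d fun h => absurd (hc d.2 (Finset.mem_image_of_mem _ h)) hd.not_ge⟩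
  choose c hc using h1
  obtain ⟨S, hS⟩ := Module.Finite.fg_top (R := PolyRing K m n) (M := M)
  obtain ⟨D, hD⟩ := (S.image c).exists_le
  refine ⟨D, fun s => ?_⟩
  induction s with
  | zero => intro x d _; simp
  | succ s ih =>
    intro x
    have hx : x ∈ Submodule.span (PolyRing K m n) (S : Set M) := hS ▸ trivial
    let I : Submodule (PolyRing K m n) M := idealQ K m n ^ (s + 1) • ⊤
    induction hx using Submodule.span_induction with
    | mem x hx =>
      intro d hd
      rw [hc x d]
      · exact Submodule.zero_mem _
      · have : c x ≤ D := hD (c x) (Finset.mem_image_of_mem c hx)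
        push_cast at hd
        omega
    | zero => intro d _; rw [map_zero]; exact Submodule.zero_mem _
    | add x y _ _ hx hy =>
      intro d hd; rw [map_add]; exact Submodule.add_mem _ (hx d hd) (hy d hd)
    | smul r x _ hx =>
      refine smul_closed_of_C_of_X (p := fun x => ∀ d : ℤ × ℤ, D + (s + 1 : ℕ) ≤ d.2 →
        G.π d x ∈ I) ?_ ?_ ?_ r hx
      · exact fun x y hx hy d hd => by rw [map_add]; exact Submodule.add_mem _ (hx d hd) (hy d hd)
      · exact fun a x hx d hd => by rw [G.π_C]; exact Submodule.smul_mem _ _ (hx d hd)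
      · intro v x hx d hd
        rw [G.π_X]
        rcases v with i | j
        · exact Submodule.smul_mem _ _ (hx _ (by simpa [varDegree] using hd))
        · have h2 := ih x (d - varDegree m n (Sum.inr j)) (by
            simp [varDegree] at hd ⊢; omega)
          change _ ∈ idealQ K m n ^ (s + 1) • (⊤ : Submodule (PolyRing K m n) M)
          rw [pow_succ', Submodule.mul_smul]
          exact Submodule.smul_mem_smul (Ideal.subset_span ⟨j, rfl⟩) h2

/-- If `M / L` is annihilated by a power of `Q` modulo `P`, it is annihilated by a power of `Q`. -/
lemma exists_pow_smul_le_of_le_sup {L : Submodule (PolyRing K m n) M} (hL : G.IsHomog L) {s : ℕ}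
    (h : idealQ K m n ^ s • ⊤ ≤ L ⊔ idealP K m n • ⊤) : ∃ s' : ℕ, idealQ K m n ^ s' • ⊤ ≤ L := by
  obtain ⟨D, hD⟩ := G.exists_forall_π_mem_pow
  obtain ⟨c₁, hc₁⟩ := exists_below_eq_top (G := G) (ℓ := AddMonoidHom.fst ℤ ℤ)
    (hℓ := fst_varDegree_nonneg) (L := L)
  obtain ⟨c₂, hc₂⟩ := exists_below_eq_top (G := G) (ℓ := AddMonoidHom.snd ℤ ℤ)
    (hℓ := snd_varDegree_nonneg) (L := L)
  -- Induction on the `x`-degree: a component of large `y`-degree lies in `Q ^ s M`, hence in `L` up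
  -- to multiples of `xᵢ`, whose coefficients have smaller `x`-degree and the same `y`-degree.
  have hhigh : ∀ (k : ℕ) (d : ℤ × ℤ) (x : M), d.1 < c₁ + k → D + s ≤ d.2 → G.π d x ∈ L := by
    intro k
    induction k with
    | zero =>
      intro d x hd _
      have hx : x ∈ G.belowX L c₁ := by rw [belowX, hc₁]; trivial
      exact hx d (by simpa using hd)
    | succ k ih =>
      intro d x hd hd2
      obtain ⟨l, hl, p, hp, hlp⟩ := Submodule.mem_sup.1 (h (hD s x d hd2))
      rw [← G.π_π, ← hlp, map_add]
      refine L.add_mem (hL d l hl) ?_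
      refine smul_top_induction (p := fun p => G.π d p ∈ L) ?_ ?_ ?_ hp
      · rw [map_zero]; exact L.zero_mem
      · intro x y hx hy; rw [map_add]; exact L.add_mem hx hy
      · intro i x
        rw [G.π_X]
        refine L.smul_mem _ (ih _ _ ?_ ?_)
        · simp [varDegree] at hd ⊢; omega
        · simpa [varDegree] using hd2
  -- Modulo `L`, a high power of `Q` leaves no components of small `y`-degree, so only those covered
  -- by `hhigh` remain.
  have hpow : ∀ k : ℕ, idealQ K m n ^ k • (⊤ : Submodule (PolyRing K m n) M) ≤
      G.belowY L (c₂ + k) := by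
    intro k
    induction k with
    | zero => rw [Nat.cast_zero, add_zero, belowY, hc₂]; exact le_top
    | succ k ih =>
      rw [pow_succ', Submodule.mul_smul]
      refine (idealQ_smul_le_belowY ih).trans (le_of_eq ?_)
      congr 1
      push_cast; ring
  refine ⟨(D + s - c₂).toNat, fun x hx => mem_of_forall_π (G := G) fun d => ?_⟩
  by_cases hd : D + s ≤ d.2
  · refine hhigh (d.1 - c₁ + 1).toNat d x ?_ hd
    have := Int.self_le_toNat (d.1 - c₁ + 1)
    omega
  · refine hpow _ hx d ?_
    have := Int.self_le_toNat (D + s - c₂)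
    simp only [AddMonoidHom.coe_snd]
    omega

end BigradedProj
end BigradedProjections
-- Duals, the determinant trick and finiteness of `M / P M`
section Parameters

open MvPolynomial

/-- A finite module over a domain that is not torsion has a nonzero dual. -/
lemma exists_dual_ne_zero {A N : Type*} [CommRing A] [IsDomain A] [AddCommGroup N] [Module A N]
    [Module.Finite A N] (h : ∀ f : A, f ≠ 0 → ∃ x : N, f • x ≠ 0) :
    ∃ (φ : N →ₗ[A] A) (x : N), φ x ≠ 0 := by
  classical
  let F := FractionRing A
  let V := LocalizedModule (nonZeroDivisors A) N
  let ι : N →ₗ[A] V := LocalizedModule.mkLinearMap (nonZeroDivisors A) N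
  obtain ⟨S, hS⟩ := Module.Finite.fg_top (R := A) (M := N)
  obtain ⟨x, hx⟩ : ∃ x, ι x ≠ 0 := by
    by_contra! h0
    have h1 : ∀ x : N, ∃ f : A, f ≠ 0 ∧ f • x = 0 := fun x => by
      obtain ⟨c, hc⟩ := (IsLocalizedModule.eq_zero_iff (nonZeroDivisors A) ι).1 (h0 x)
      exact ⟨c, nonZeroDivisors.ne_zero c.2, hc⟩
    choose f hf hfx using h1
    obtain ⟨x, hx⟩ := h (∏ y ∈ S, f y) (Finset.prod_ne_zero_iff.2 fun y _ => hf y)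
    refine hx ?_
    have hle : Submodule.span A (S : Set N) ≤ LinearMap.ker ((∏ y ∈ S, f y) • LinearMap.id) := by
      refine Submodule.span_le.2 fun y hy => ?_
      obtain ⟨c, hc⟩ := Finset.dvd_prod_of_mem f hy
      simp only [SetLike.mem_coe, LinearMap.mem_ker, LinearMap.smul_apply, LinearMap.id_apply]
      rw [hc, mul_comm, mul_smul, hfx, smul_zero]
    exact hle (hS ▸ trivial)
  obtain ⟨ψ, hψ⟩ : ∃ ψ : Module.Dual F V, ψ (ι x) ≠ 0 := by
    by_contra! h0
    exact hx ((Module.forall_dual_apply_eq_zero_iff F _).1 h0)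
  -- A common denominator of `ψ` on the generators makes `b • ψ` take values in `A`.
  obtain ⟨b, hb⟩ := IsLocalization.exist_integer_multiples_of_finset (nonZeroDivisors A)
    (S.image fun y => ψ (ι y))
  let χ : N →ₗ[A] F := (b : A) • ((ψ.restrictScalars A) ∘ₗ ι)
  have hχ : LinearMap.range χ ≤ LinearMap.range (Algebra.linearMap A F) := by
    rw [LinearMap.range_eq_map, ← hS, Submodule.map_span_le]
    intro y hy
    obtain ⟨c, hc⟩ := hb _ (Finset.mem_image_of_mem _ hy)
    exact ⟨c, hc⟩
  let E := LinearEquiv.ofInjective (Algebra.linearMap A F) (IsFractionRing.injective A F)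
  refine ⟨E.symm.toLinearMap ∘ₗ LinearMap.codRestrict _ χ fun y => hχ ⟨y, rfl⟩, x, ?_⟩
  intro h0
  have h1 := (LinearEquiv.map_eq_zero_iff E.symm).1 h0
  have h2 : (b : A) • ψ (ι x) = 0 := congrArg Subtype.val h1
  rcases smul_eq_zero.1 h2 with h3 | h3
  · exact nonZeroDivisors.ne_zero b.2 h3
  · exact hψ h3

/-- Cayley–Hamilton: `y ^ s` maps `X` into `I X`, so it satisfies on `X` a monic equation with lower
coefficients in `I`, and a power of `y` lies in `ann X + I`. -/
lemma le_radical_of_pow_smul_le {R X : Type*} [CommRing R] [AddCommGroup X] [Module R X]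
    [Module.Finite R X] {J I : Ideal R} {s : ℕ}
    (h : J ^ s • (⊤ : Submodule R X) ≤ I • ⊤) : J ≤ (Module.annihilator R X ⊔ I).radical := by
  intro y hy
  obtain ⟨p, hp, -, hpc, hp0⟩ :=
    LinearMap.exists_monic_and_natDegree_eq_and_coeff_mem_pow_and_aeval_eq_zero
    (R := R) (algebraMap R (Module.End R X) (y ^ s)) I (by
      rintro _ ⟨x, rfl⟩
      exact h (Submodule.smul_mem_smul (Ideal.pow_mem_pow hy s) trivial))
  have h1 : p.eval (y ^ s) ∈ Module.annihilator R X := by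
    rw [Module.mem_annihilator]
    intro x
    rw [Polynomial.aeval_algebraMap_apply, Polynomial.coe_aeval_eq_eval] at hp0
    exact congr($hp0 x)
  refine ⟨s * p.natDegree, ?_⟩
  rw [Polynomial.eval_eq_sum_range, Finset.sum_range_succ, hp.coeff_natDegree, one_mul,
    ← pow_mul] at h1
  have h2 : ∑ i ∈ Finset.range p.natDegree, p.coeff i * (y ^ s) ^ i ∈ I := by
    refine I.sum_mem fun i hi => I.mul_mem_right _ ?_
    rw [Finset.mem_range] at hi
    exact Ideal.pow_le_self (by omega) (hpc i)
  exact (Submodule.add_mem_iff_right _ (Ideal.mem_sup_right h2)).1 (Ideal.mem_sup_left h1)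

variable {K : Type u} [Field K] {m n : ℕ}

lemma finite_quotient_idealP_sup_pow (s : ℕ) :
    Module.Finite K (PolyRing K m n ⧸ (idealP K m n ⊔ idealQ K m n ^ s)) := by
  have hX : ∀ v : Fin m ⊕ Fin n, IsIntegral K
      (Ideal.Quotient.mk (idealP K m n ⊔ idealQ K m n ^ s) (X v)) := by
    rintro (i | j)
    · rw [Ideal.Quotient.eq_zero_iff_mem.2
        (Ideal.mem_sup_left (show X (Sum.inl i) ∈ idealP K m n from Ideal.subset_span ⟨i, rfl⟩))]
      exact isIntegral_zero
    · have hj : (X (Sum.inr j) : PolyRing K m n) ∈ idealQ K m n := Ideal.subset_span ⟨j, rfl⟩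
      refine ⟨Polynomial.X ^ s, Polynomial.monic_X_pow s, ?_⟩
      rw [Polynomial.eval₂_X_pow]
      rw [← map_pow, Ideal.Quotient.eq_zero_iff_mem]
      exact Ideal.mem_sup_right (Ideal.pow_mem_pow hj s)
  have : Algebra.IsIntegral K (PolyRing K m n ⧸ (idealP K m n ⊔ idealQ K m n ^ s)) := by
    refine ⟨fun x => ?_⟩
    obtain ⟨p, rfl⟩ := Ideal.Quotient.mk_surjective x
    induction p using MvPolynomial.induction_on with
    | C a => exact isIntegral_algebraMap
    | add p q hp hq => rw [map_add]; exact hp.add hq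
    | mul_X p v hp => rw [map_mul]; exact hp.mul (hX v)
  exact Algebra.IsIntegral.finite

lemma exists_finset_span_sup (s : ℕ) : ∃ E : Finset (PolyRing K m n), ∀ r : PolyRing K m n,
    ∃ b ∈ Submodule.span K (E : Set (PolyRing K m n)), r - b ∈ idealP K m n ⊔ idealQ K m n ^ s := by
  classical
  obtain ⟨B, hB⟩ := (finite_quotient_idealP_sup_pow (K := K) (m := m) (n := n) s).fg_top
  let q := (Ideal.Quotient.mkₐ K (idealP K m n ⊔ idealQ K m n ^ s)).toLinearMap
  have hq : Function.Surjective q := Ideal.Quotient.mk_surjective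
  refine ⟨B.image (Function.surjInv hq), fun r => ?_⟩
  have h1 : q r ∈ Submodule.map q (Submodule.span K (B.image (Function.surjInv hq) : Set _)) := by
    rw [Submodule.map_span, Finset.coe_image, ← Set.image_comp]
    have : (q ∘ Function.surjInv hq) = id := funext fun x => Function.surjInv_eq hq x
    rw [this, Set.image_id, hB]
    trivial
  obtain ⟨b, hb, hbr⟩ := h1
  exact ⟨b, hb, Ideal.Quotient.eq.1 hbr.symm⟩

variable {M : Type u} [AddCommGroup M] [Module (PolyRing K m n) M] [Module.Finite (PolyRing K m n) M]
  (G : BigradedProj K m n M)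

section Finiteness

variable {A : Type*} [CommRing A] [Algebra A (PolyRing K m n)] [Module A M]
  [IsScalarTower A (PolyRing K m n) M] {a : ℕ} {t : Fin a → A} {e : ℕ}

include G in
/-- `M / P M` is finite over any ring of parameters. -/
lemma finite_quotient_idealP_smul (hK : ∀ k : K, ∃ α : A, algebraMap A (PolyRing K m n) α = C k)
    (he : 0 < e) (ht : ∀ i, IsWeightedHomogeneous (varDegree m n)
      (algebraMap A (PolyRing K m n) (t i)) ((0, (e : ℤ)) : ℤ × ℤ)) {s : ℕ}
    (hs : idealQ K m n ^ s • (⊤ : Submodule (PolyRing K m n) M) ≤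
      Ideal.span (Set.range fun i => algebraMap A (PolyRing K m n) (t i)) • ⊤) :
    Module.Finite A (M ⧸ (idealP K m n • ⊤ : Submodule (PolyRing K m n) M)) := by
  classical
  obtain ⟨E, hE⟩ := exists_finset_span_sup (K := K) (m := m) (n := n) s
  obtain ⟨S, hS⟩ := Module.Finite.fg_top (R := PolyRing K m n) (M := M)
  choose supp hsupp using fun x => G.exists_sum x
  -- The homogeneous components of the products of a finite `K`-spanning set modulo `P + Q ^ s` with
  -- the generators of `M`; by `hcover` they span `M` over `K` modulo `P M + θ M`.
  let F : Finset M := E.biUnion fun r => S.biUnion fun g => (supp (r • g)).image fun d => G.π d (r • g)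
  let PM : Submodule (PolyRing K m n) M := idealP K m n • ⊤
  let θM : Submodule (PolyRing K m n) M :=
    Ideal.span (Set.range fun i => algebraMap A (PolyRing K m n) (t i)) • ⊤
  let Z : Submodule A M := Submodule.span A (F : Set M) ⊔ PM.restrictScalars A
  have hPM : G.IsHomog PM := by
    refine BigradedProj.IsHomog.span_smul_top (δ := fun i => varDegree m n (Sum.inl i)) fun i => ?_
    exact isWeightedHomogeneous_X _ _ _
  have hCZ : ∀ (k : K) (Y : Submodule A M) (x : M), x ∈ Y → (C k : PolyRing K m n) • x ∈ Y := by
    intro k Y x hx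
    obtain ⟨α, hα⟩ := hK k
    rw [← hα, algebraMap_smul]
    exact Y.smul_mem α hx
  let _ : Module K M := Module.compHom M (algebraMap K (PolyRing K m n))
  have : IsScalarTower K (PolyRing K m n) M := IsScalarTower.of_algebraMap_smul fun _ _ => rfl
  have hF : ∀ b ∈ Submodule.span K (E : Set (PolyRing K m n)), ∀ g ∈ S,
      b • g ∈ Submodule.span K (F : Set M) := by
    intro b hb g hg
    induction hb using Submodule.span_induction with
    | mem b hb =>
      rw [hsupp (b • g)]
      refine Submodule.sum_mem _ fun d hd => Submodule.subset_span ?_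
      exact Finset.mem_biUnion.2 ⟨b, hb, Finset.mem_biUnion.2 ⟨g, hg,
        Finset.mem_image_of_mem _ hd⟩⟩
    | zero => rw [zero_smul]; exact Submodule.zero_mem _
    | add b c _ _ hb hc => rw [add_smul]; exact Submodule.add_mem _ hb hc
    | smul k b _ hb => rw [smul_assoc]; exact Submodule.smul_mem _ k hb
  have hcover : ∀ x : M, x ∈ Submodule.span K (F : Set M) ⊔ (PM ⊔ θM).restrictScalars K := by
    intro x
    have hx : x ∈ Submodule.span (PolyRing K m n) (S : Set M) := hS ▸ trivial
    obtain ⟨r, -, rfl⟩ := Submodule.mem_span_finset.1 hx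
    refine Submodule.sum_mem _ fun g hg => ?_
    obtain ⟨b, hb, hrb⟩ := hE (r g)
    have h1 : (r g - b) • g ∈ PM ⊔ θM := by
      have := Submodule.smul_mem_smul hrb (Submodule.mem_top (x := g) (R := PolyRing K m n))
      rw [Submodule.sup_smul] at this
      exact sup_le_sup_left hs _ this
    have : r g • g = b • g + (r g - b) • g := by rw [← add_smul, add_sub_cancel]
    rw [this]
    exact Submodule.add_mem_sup (hF b hb g hg) h1
  obtain ⟨c, hc⟩ := BigradedProj.exists_below_eq_top (G := G) (ℓ := AddMonoidHom.snd ℤ ℤ)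
    (hℓ := BigradedProj.snd_varDegree_nonneg) (L := ⊥)
  -- Induction on the `y`-degree: the part in `θ M` has coefficients whose `y`-degree is smaller by
  -- `e > 0`.
  have key : ∀ (k : ℕ) (d : ℤ × ℤ), d.2 < c + k → ∀ x, G.π d x ∈ Z := by
    intro k
    induction k with
    | zero =>
      intro d hd x
      have hx : x ∈ G.belowY ⊥ c := by rw [BigradedProj.belowY, hc]; trivial
      rw [(Submodule.mem_bot _).1 (hx d (by simpa using hd))]
      exact Z.zero_mem
    | succ k ih =>
      intro d hd x
      obtain ⟨z, hz, y, hy, rfl⟩ := Submodule.mem_sup.1 (hcover x)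
      obtain ⟨p, hp, q, hq, rfl⟩ := Submodule.mem_sup.1 ((Submodule.restrictScalars_mem A _ _).1 hy)
      rw [map_add, map_add]
      refine Z.add_mem ?_ (Z.add_mem (Submodule.mem_sup_right (hPM d p hp)) ?_)
      · induction hz using Submodule.span_induction with
        | mem f hf =>
          have hf' := hf
          obtain ⟨r, -, hf⟩ := Finset.mem_biUnion.1 hf
          obtain ⟨g, -, hf⟩ := Finset.mem_biUnion.1 hf
          obtain ⟨d', hd', rfl⟩ := Finset.mem_image.1 hf
          by_cases h : d = d'
          · subst h
            rw [G.π_π]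
            exact Submodule.mem_sup_left (Submodule.subset_span hf')
          · rw [G.π_π_ne _ _ _ h]; exact Z.zero_mem
        | zero => rw [map_zero]; exact Z.zero_mem
        | add x y _ _ hx hy => rw [map_add]; exact Z.add_mem hx hy
        | smul k x _ hx =>
          have : k • x = (C k : PolyRing K m n) • x := rfl
          rw [this, G.π_C]
          exact hCZ k Z _ hx
      · refine smul_top_induction (p := fun q => G.π d q ∈ Z) ?_ ?_ ?_ hq
        · rw [map_zero]; exact Z.zero_mem
        · intro x y hx hy; rw [map_add]; exact Z.add_mem hx hy
        · intro i x
          rw [G.π_smul_of_isWeightedHomogeneous (ht i), algebraMap_smul]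
          refine Z.smul_mem _ (ih _ ?_ x)
          push_cast at hd
          simp
          omega
  have hZ : ∀ x, x ∈ Z := by
    intro x
    rw [hsupp x]
    refine Z.sum_mem fun d _ => key (d.2 - c + 1).toNat d ?_ x
    have := Int.self_le_toNat (d.2 - c + 1)
    omega
  refine ⟨⟨F.image (Submodule.mkQ PM), ?_⟩⟩
  have hmap : Submodule.span A ((F.image (Submodule.mkQ PM) : Finset (M ⧸ PM)) : Set (M ⧸ PM)) =
      (Submodule.span A (F : Set M)).map ((Submodule.mkQ PM).restrictScalars A) := by
    rw [Submodule.map_span, Finset.coe_image]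
    rfl
  rw [hmap, eq_top_iff]
  rintro y -
  obtain ⟨x, rfl⟩ := Submodule.mkQ_surjective _ y
  obtain ⟨z, hz, p, hp, rfl⟩ := Submodule.mem_sup.1 (hZ x)
  refine ⟨z, hz, ?_⟩
  have h0 : PM.mkQ p = 0 := (Submodule.Quotient.mk_eq_zero PM).2 hp
  rw [map_add]
  exact (add_zero _).symm.trans (congrArg (PM.mkQ z + ·) h0.symm)

end Finiteness

end Parameters
-- Nonvanishing at the minimal number of parameters
section Nonvanishing

open MvPolynomial

variable {K : Type u} [Field K] {m n : ℕ}

/-- `(X₁⋯Xₐ)ˢ p` lies in `(X₁ᵏ, …, Xₐᵏ)` only if `p` is zero or has large degree. -/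
lemma eq_zero_of_prod_X_pow_mul_mem {a : ℕ} {p : MvPolynomial (Fin a) K} {s : ℕ}
    (h : (∏ i, X i) ^ s * p ∈
      Ideal.span (Set.range fun i : Fin a => (X i : MvPolynomial (Fin a) K) ^ (p.totalDegree + 1 + s))) :
    p = 0 := by
  by_contra hp
  obtain ⟨u, hu⟩ := exists_coeff_ne_zero hp
  let w : Fin a →₀ ℕ := Finsupp.equivFunOnFinite.symm fun _ => s
  have hw : ((∏ i, X i) ^ s : MvPolynomial (Fin a) K) = monomial w 1 := by
    rw [monomial_eq, C_1, one_mul, Finsupp.prod_fintype _ _ (by simp), ← Finset.prod_pow]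
    rfl
  have hrange : (Set.range fun i : Fin a => (X i : MvPolynomial (Fin a) K) ^ (p.totalDegree + 1 + s)) =
      (fun u => monomial u 1) '' Set.range fun i => Finsupp.single i (p.totalDegree + 1 + s) := by
    rw [← Set.range_comp]
    congr 1
    ext1 i
    simp [X_pow_eq_monomial]
  rw [hw, hrange, mem_ideal_span_monomial_image] at h
  obtain ⟨_, ⟨i, rfl⟩, hi⟩ := h (w + u) (by
    rw [mem_support_iff, coeff_monomial_mul, one_mul]
    exact hu)
  have h1 := hi i
  have h2 : u i ≤ p.totalDegree := by
    refine (Finsupp.le_degree i u).trans ?_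
    have := le_totalDegree (mem_support_iff.2 hu)
    simpa [Finsupp.degree_eq_sum, Finsupp.sum_fintype] using this
  simp [w] at h1
  omega

variable {M : Type u} [AddCommGroup M] [Module (PolyRing K m n) M] [Module.Finite (PolyRing K m n) M]

/-- `M` has `a` homogeneous parameters of the same degree in the `y`-variables. -/
def HasParameters (M : Type u) [AddCommGroup M] [Module (PolyRing K m n) M] (a : ℕ) : Prop :=
  ∃ (e : ℕ) (θ : Fin a → PolyRing K m n), 0 < e ∧
    (∀ i, IsWeightedHomogeneous (varDegree m n) (θ i) ((0, (e : ℤ)) : ℤ × ℤ)) ∧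
    (∀ i, θ i ∈ idealQ K m n) ∧ ∃ s : ℕ, idealQ K m n ^ s • (⊤ : Submodule (PolyRing K m n) M) ≤
      Ideal.span (Set.range θ) • ⊤

omit [Module.Finite (PolyRing K m n) M] in
lemma hasParameters_n : HasParameters (K := K) (m := m) (n := n) M n := by
  refine ⟨1, fun j => X (Sum.inr j), one_pos, fun j => ?_, fun j => Ideal.subset_span ⟨j, rfl⟩, 1, ?_⟩
  · exact isWeightedHomogeneous_X K (varDegree m n) (Sum.inr j)
  · rw [pow_one]; rfl

section

variable {a : ℕ} {e : ℕ} {θ : Fin a → PolyRing K m n}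

lemma isWeightedHomogeneous_aeval {D : ℕ} (hθ : ∀ i, IsWeightedHomogeneous (varDegree m n) (θ i)
    ((0, (e : ℤ)) : ℤ × ℤ)) {f : MvPolynomial (Fin a) K} (hf : f.IsHomogeneous D) :
    IsWeightedHomogeneous (varDegree m n) (aeval θ f) ((0, ((D * e : ℕ) : ℤ)) : ℤ × ℤ) := by
  rw [aeval_def, eval₂_eq]
  refine IsWeightedHomogeneous.sum _ _ _ fun u hu => ?_
  have hd : ∑ i ∈ u.support, u i = D := by
    have := hf (mem_support_iff.1 hu)
    simpa [Finsupp.weight_apply, Finsupp.sum] using this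
  have h1 : IsWeightedHomogeneous (varDegree m n) (∏ i ∈ u.support, θ i ^ u i)
      (∑ i ∈ u.support, u i • ((0, (e : ℤ)) : ℤ × ℤ)) :=
    IsWeightedHomogeneous.prod _ _ _ fun i _ => (hθ i).pow _
  rw [← Finset.sum_smul, hd] at h1
  have h2 := (isWeightedHomogeneous_C (varDegree m n) (coeff u f)).mul h1
  rw [zero_add] at h2
  convert h2 using 1
  · simp
  · ext <;> simp

lemma aeval_mem_of_isHomogeneous {D : ℕ} (hD : 0 < D) {I : Ideal (PolyRing K m n)}
    (hθ : ∀ i, θ i ∈ I) {f : MvPolynomial (Fin a) K} (hf : f.IsHomogeneous D) : aeval θ f ∈ I := by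
  rw [aeval_def, eval₂_eq]
  refine I.sum_mem fun u hu => I.mul_mem_left _ ?_
  have hd : ∑ i ∈ u.support, u i = D := by
    have := hf (mem_support_iff.1 hu)
    simpa [Finsupp.weight_apply, Finsupp.sum] using this
  obtain ⟨i, hi, hi0⟩ := Finset.exists_ne_zero_of_sum_ne_zero (hd.trans_ne hD.ne')
  exact I.mem_of_dvd (Finset.dvd_prod_of_mem _ hi) (I.pow_mem_of_mem (hθ i) _ (Nat.pos_of_ne_zero hi0))

/-- A form in the parameters that acts as zero on `M / P M` allows to save a parameter. -/
lemma hasParameters_of_form {b : ℕ} {θ : Fin (b + 1) → PolyRing K m n} (G : BigradedProj K m n M)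
    (he : 0 < e) (hθ : ∀ i, IsWeightedHomogeneous (varDegree m n) (θ i) ((0, (e : ℤ)) : ℤ × ℤ))
    (hθQ : ∀ i, θ i ∈ idealQ K m n) {s : ℕ}
    (hs : idealQ K m n ^ s • (⊤ : Submodule (PolyRing K m n) M) ≤ Ideal.span (Set.range θ) • ⊤)
    {f : MvPolynomial (Fin (b + 1)) K} {D : ℕ} (hf : f.IsHomogeneous D) (hf0 : f ≠ 0)
    (hfM : ∀ x : M, aeval θ f • x ∈ idealP K m n • (⊤ : Submodule (PolyRing K m n) M)) :
    HasParameters (K := K) (m := m) (n := n) M b := by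
  obtain ⟨d, η, hd, hη, hX⟩ := exists_forms_radical hf hf0
  have hhom := fun i => isWeightedHomogeneous_aeval hθ (hη i)
  refine ⟨d * e, fun i => aeval θ (η i), Nat.mul_pos hd he, hhom,
    fun i => aeval_mem_of_isHomogeneous hd hθQ (hη i), ?_⟩
  -- Substituting `θ` for the variables carries the radical membership of `exists_forms_radical`
  -- over to the parameters.
  have hrad : Ideal.span (Set.range θ) ≤
      (Ideal.span {aeval θ f} ⊔ Ideal.span (Set.range fun i => aeval θ (η i))).radical := by
    rw [Ideal.span_le]
    rintro _ ⟨j, rfl⟩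
    obtain ⟨k, hk⟩ := hX j
    refine ⟨k, ?_⟩
    have h1 := Ideal.mem_map_of_mem (aeval θ : _ →ₐ[K] PolyRing K m n) hk
    rw [Ideal.map_sup, Ideal.map_span, Ideal.map_span, Set.image_singleton, ← Set.range_comp,
      map_pow, aeval_X] at h1
    exact h1
  obtain ⟨w, hw⟩ := Ideal.exists_pow_le_of_le_radical_of_fg hrad (IsNoetherian.noetherian _)
  have hpow : ∀ k : ℕ, idealQ K m n ^ (s * k) • (⊤ : Submodule (PolyRing K m n) M) ≤
      Ideal.span (Set.range θ) ^ k • ⊤ := by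
    intro k
    induction k with
    | zero => simp
    | succ k ih =>
      rw [Nat.mul_succ, pow_add, Submodule.mul_smul]
      refine (Submodule.smul_mono le_rfl hs).trans ?_
      rw [← Submodule.mul_smul, mul_comm, Submodule.mul_smul]
      refine (Submodule.smul_mono le_rfl ih).trans ?_
      rw [← Submodule.mul_smul, ← pow_succ']
  refine BigradedProj.exists_pow_smul_le_of_le_sup (G := G) (s := s * w)
    (BigradedProj.IsHomog.span_smul_top hhom) ?_
  refine (hpow w).trans ((Submodule.smul_mono_left hw).trans ?_)
  rw [Submodule.sup_smul, sup_comm]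
  refine sup_le_sup_left ?_ _
  rw [Submodule.smul_le]
  intro r hr x _
  obtain ⟨c, rfl⟩ := Ideal.mem_span_singleton'.1 hr
  rw [mul_smul]
  exact Submodule.smul_mem _ _ (hfM x)

omit [Module.Finite (PolyRing K m n) M] in
/-- The homogeneous components of a polynomial in the parameters acting as zero on `M / P M`
act as zero. -/
lemma aeval_homogeneousComponent_smul_mem (G : BigradedProj K m n M)
    (he : 0 < e) (hθ : ∀ i, IsWeightedHomogeneous (varDegree m n) (θ i) ((0, (e : ℤ)) : ℤ × ℤ))
    {L : Submodule (PolyRing K m n) M} (hL : G.IsHomog L)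
    {f : MvPolynomial (Fin a) K} (hf : ∀ x : M, aeval θ f • x ∈ L) (D : ℕ) (x : M) :
    aeval θ (homogeneousComponent D f) • x ∈ L := by
  obtain ⟨s, hs⟩ := G.exists_sum x
  rw [hs, Finset.smul_sum]
  refine L.sum_mem fun d _ => ?_
  -- On the homogeneous element `π d x`, distinct components of `f` land in distinct bidegrees
  -- because `e > 0`; this bidegree isolates the one of degree `D`.
  have h1 := hL (d + (0, ((D * e : ℕ) : ℤ))) _ (hf (G.π d x))
  conv at h1 => rw [← sum_homogeneousComponent f]
  rw [map_sum, Finset.sum_smul, map_sum] at h1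
  by_cases hD : D ∈ Finset.range (f.totalDegree + 1)
  · rw [Finset.sum_eq_single_of_mem D hD, G.π_smul_of_isWeightedHomogeneous
      (isWeightedHomogeneous_aeval hθ (homogeneousComponent_isHomogeneous D f)), add_sub_cancel_right,
      G.π_π] at h1
    · exact h1
    · intro k _ hk
      rw [G.π_smul_of_isWeightedHomogeneous
        (isWeightedHomogeneous_aeval hθ (homogeneousComponent_isHomogeneous k f)), G.π_π_ne, smul_zero]
      intro h
      apply hk
      have h2 := congrArg Prod.snd h
      simp at h2
      have h3 : (k : ℤ) * e = D * e := by linarith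
      exact_mod_cast mul_right_cancel₀ (by exact_mod_cast he.ne') h3
  · rw [homogeneousComponent_eq_zero _ _ (by simpa using hD), map_zero, zero_smul]
    exact L.zero_mem

/-- A minimal number of parameters is an index of nonvanishing local cohomology. -/
lemma not_van_of_forall_not_hasParameters [Nontrivial M] (G : BigradedProj K m n M)
    (he : 0 < e) (hθ : ∀ i, IsWeightedHomogeneous (varDegree m n) (θ i) ((0, (e : ℤ)) : ℤ × ℤ))
    (hθQ : ∀ i, θ i ∈ idealQ K m n) {s : ℕ}
    (hs : idealQ K m n ^ s • (⊤ : Submodule (PolyRing K m n) M) ≤ Ideal.span (Set.range θ) • ⊤)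
    (hmin : ∀ b < a, ¬ HasParameters (K := K) (m := m) (n := n) M b) :
    ¬ Van (idealQ K m n) a M := by
  intro hV
  let A := MvPolynomial (Fin a) K
  let _ : Algebra A (PolyRing K m n) := (aeval θ : A →ₐ[K] PolyRing K m n).toRingHom.toAlgebra
  let _ : Module A M := Module.compHom M (algebraMap A (PolyRing K m n))
  have : IsScalarTower A (PolyRing K m n) M := IsScalarTower.of_algebraMap_smul fun _ _ => rfl
  have halg : ∀ f : A, algebraMap A (PolyRing K m n) f = aeval θ f := fun _ => rfl
  have hsmul : ∀ (f : A) (x : M), f • x = aeval θ f • x := fun _ _ => rfl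
  let PM : Submodule (PolyRing K m n) M := idealP K m n • ⊤
  have hPM : G.IsHomog PM := by
    refine BigradedProj.IsHomog.span_smul_top (δ := fun i => varDegree m n (Sum.inl i)) fun i => ?_
    exact isWeightedHomogeneous_X _ _ _
  have hfin : Module.Finite A (M ⧸ PM) := by
    refine finite_quotient_idealP_smul G (A := A) (t := X) (e := e) (s := s)
      (fun k => ⟨C k, ?_⟩) he (fun i => ?_) ?_
    · rw [halg, aeval_C]; rfl
    · rw [halg, aeval_X]; exact hθ i
    · simpa only [halg, aeval_X] using hs
  obtain ⟨φ, y, hy⟩ := exists_dual_ne_zero (A := A) (N := M ⧸ PM) (by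
    intro f hf
    by_contra! h0
    have hfM : ∀ x : M, aeval θ f • x ∈ PM := fun x =>
      (Submodule.Quotient.mk_eq_zero PM).1 (h0 (Submodule.Quotient.mk x))
    -- Without parameters `f` is a nonzero constant, so `P M = M` and graded Nakayama gives `M = 0`.
    -- Otherwise a nonzero homogeneous component of `f` would save a parameter, against minimality.
    cases a with
    | zero =>
      obtain ⟨c, rfl⟩ := C_surjective (Fin 0) f
      have hc : c ≠ 0 := fun h => hf (by rw [h, map_zero])
      refine not_subsingleton M (BigradedProj.subsingleton_of_idealP_smul_top ?_ G)
      rw [eq_top_iff]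
      rintro x -
      have h1 := hfM ((C c⁻¹ : PolyRing K m n) • x)
      rwa [aeval_C, algebraMap_eq, smul_smul, ← C_mul, mul_inv_cancel₀ hc, C_1, one_smul] at h1
    | succ b =>
      obtain ⟨D, hD⟩ : ∃ D, homogeneousComponent D f ≠ 0 := by
        by_contra! h1
        apply hf
        rw [← sum_homogeneousComponent f]
        exact Finset.sum_eq_zero fun D _ => h1 D
      exact hmin b (Nat.lt_succ_self b) (hasParameters_of_form G he hθ hθQ hs
        (homogeneousComponent_isHomogeneous D f) hD
        (aeval_homogeneousComponent_smul_mem G he hθ hPM hfM D)))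
  obtain ⟨x, rfl⟩ := Submodule.mkQ_surjective _ y
  have hset : {z | z ∈ List.ofFn θ} = Set.range θ := by ext z; simp
  -- The exponent `t` is taken above the degree of `φ x`, so that after applying `φ` no monomial of
  -- `(∏ Xᵢ) ^ k * φ x` can be divisible by an `Xᵢ ^ (t + k)`.
  obtain ⟨k, hk⟩ := exists_prod_pow_smul_mem (List.ofFn θ) (J := idealQ K m n)
    (by simpa using hθQ) (Module.annihilator (PolyRing K m n) M)
    (by rw [hset]; exact le_radical_of_pow_smul_le hs) M
    (fun z => ⟨1, fun r hr => Module.mem_annihilator.1 (by simpa using hr) z⟩)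
    (by rwa [List.length_ofFn]) x ((φ (Submodule.mkQ PM x)).totalDegree + 1)
  rw [hset, ← Set.range_comp, List.prod_ofFn] at hk
  apply hy
  refine eq_zero_of_prod_X_pow_mul_mem (s := k) ?_
  have h1 : (∏ i, X i) ^ k * φ (Submodule.mkQ PM x) = φ (Submodule.mkQ PM ((∏ i, θ i) ^ k • x)) := by
    have h2 : (∏ i, θ i) ^ k • x = ((∏ i, X i) ^ k : A) • x := by
      rw [hsmul]; simp
    rw [h2, ← smul_eq_mul, ← map_smul]
    rfl
  rw [h1]
  refine smul_top_induction (p := fun z => φ (Submodule.mkQ PM z) ∈ Ideal.span (Set.range fun i =>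
    (X i : A) ^ ((φ (Submodule.mkQ PM x)).totalDegree + 1 + k))) ?_ ?_ ?_ hk
  · rw [map_zero, map_zero]; exact Submodule.zero_mem _
  · intro z w hz hw; rw [map_add, map_add]; exact Submodule.add_mem _ hz hw
  · intro i z
    have h2 : (((· ^ ((φ (Submodule.mkQ PM x)).totalDegree + 1 + k)) ∘ θ) i) • z =
        ((X i : A) ^ ((φ (Submodule.mkQ PM x)).totalDegree + 1 + k)) • z := by
      rw [hsmul]; simp
    have h3 : φ (Submodule.mkQ PM (((X i : A) ^ ((φ (Submodule.mkQ PM x)).totalDegree + 1 + k)) • z)) =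
        ((X i : A) ^ ((φ (Submodule.mkQ PM x)).totalDegree + 1 + k)) * φ (Submodule.mkQ PM z) := by
      rw [← smul_eq_mul, ← map_smul]
      rfl
    rw [h2, h3]
    exact Ideal.mul_mem_right _ _ (Ideal.subset_span ⟨i, rfl⟩)

end

/-- A nonzero finite bigraded module has parameters whose number is bounded by the cohomological
dimension. -/
theorem exists_parameters_not_van [Nontrivial M] (G : BigradedProj K m n M) :
    ∃ l : List (PolyRing K m n), (∀ x ∈ l, x ∈ idealQ K m n) ∧
      idealQ K m n ≤ (Module.annihilator (PolyRing K m n) M ⊔ Ideal.span {x | x ∈ l}).radical ∧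
      ¬ Van (idealQ K m n) l.length M := by
  classical
  have hex : ∃ a, HasParameters (K := K) (m := m) (n := n) M a := ⟨n, hasParameters_n⟩
  obtain ⟨e, θ, he, hθ, hθQ, s, hs⟩ := Nat.find_spec hex
  have hset : {z | z ∈ List.ofFn θ} = Set.range θ := by ext z; simp
  refine ⟨List.ofFn θ, by simpa using hθQ, ?_, ?_⟩
  · rw [hset]; exact le_radical_of_pow_smul_le hs
  · rw [List.length_ofFn]
    exact not_van_of_forall_not_hasParameters G he hθ hθQ hs fun b hb => Nat.find_min hex hb

end Nonvanishing
-- Cohomological dimension from vanishing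
section CohomologicalDimension

open CategoryTheory

variable {R : Type u} [CommRing R] {J : Ideal R} {X Y : Type u} [AddCommGroup X] [Module R X]
  [AddCommGroup Y] [Module R Y]

lemma nontrivial_localCohomology_iff {i : ℕ} :
    Nontrivial ((localCohomology J i).obj (ModuleCat.of R X)) ↔ ¬ Van J i X := by
  rw [← not_subsingleton_iff_nontrivial, subsingleton_localCohomology_iff]

lemma le_cd {i : ℕ} (h : ¬ Van J i X) : ((i : ℕ∞) : WithBot ℕ∞) ≤ cd J X :=
  le_iSup₂_of_le i (nontrivial_localCohomology_iff.2 h) le_rfl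

lemma cd_le {c : WithBot ℕ∞} (h : ∀ i : ℕ, ¬ Van J i X → ((i : ℕ∞) : WithBot ℕ∞) ≤ c) : cd J X ≤ c :=
  iSup₂_le fun i hi => h i (nontrivial_localCohomology_iff.1 hi)

lemma cd_eq {q : ℕ} (h : ∀ i, q < i → Van J i X) (hq : ¬ Van J q X) :
    cd J X = ((q : ℕ∞) : WithBot ℕ∞) := by
  refine le_antisymm (cd_le fun i hi => ?_) (le_cd hq)
  have : i ≤ q := not_lt.1 fun hqi => hi (h i hqi)
  exact_mod_cast this

lemma cd_lt_of_forall_van {q : ℕ} (h : ∀ i, q ≤ i → Van J i X) :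
    cd J X < ((q : ℕ∞) : WithBot ℕ∞) := by
  cases q with
  | zero =>
    refine lt_of_le_of_lt (cd_le (c := ⊥) fun i hi => (hi (h i i.zero_le)).elim) ?_
    exact WithBot.bot_lt_coe _
  | succ q =>
    refine lt_of_le_of_lt (cd_le (c := ((q : ℕ∞) : WithBot ℕ∞)) fun i hi => ?_) ?_
    · have : i ≤ q := by
        by_contra! hqi
        exact hi (h i hqi)
      exact_mod_cast this
    · exact_mod_cast Nat.lt_succ_self q

/-- A relative Cohen–Macaulay module of nonnegative cohomological dimension has exactly one
nonvanishing local cohomology module. -/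
lemma IsRelCohenMacaulay.exists_van (h : IsRelCohenMacaulay J X) (h0 : 0 ≤ cd J X) :
    ∃ q : ℕ, (∀ i, i ≠ q → Van J i X) ∧ ¬ Van J q X := by
  obtain ⟨q, hq⟩ := h
  obtain ⟨p, hp⟩ : ∃ p : ℕ, ¬ Van J p X := by
    by_contra! hall
    have h1 : cd J X ≤ ⊥ := cd_le fun i hi => (hi (hall i)).elim
    exact absurd (h0.trans h1) (by simp)
  have hpq : (p : ℤ) = q := by
    by_contra hne
    exact hp ((subsingleton_localCohomology_iff J p _).1 (hq p hne))
  refine ⟨p, fun i hi => (subsingleton_localCohomology_iff J i _).1 (hq i ?_), hp⟩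
  rw [← hpq]
  exact_mod_cast hi

end CohomologicalDimension

/-! ### Cohen–Macaulay and dimension filtrations -/

section Filtrations

open MvPolynomial

variable {K : Type u} [Field K] {m n : ℕ} {M : Type u} [AddCommGroup M] [Module (PolyRing K m n) M]

lemma decompose_smul (ℳ : ℤ × ℤ → AddSubgroup M) [DirectSum.Decomposition ℳ]
    [SetLike.GradedSMul (stdBigrading K m n) ℳ] {r : PolyRing K m n} {δ : ℤ × ℤ}
    (hr : r ∈ stdBigrading K m n δ) (d : ℤ × ℤ) (x : M) :
    (DirectSum.decompose ℳ (r • x) d : M) = r • (DirectSum.decompose ℳ x (d - δ) : M) := by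
  induction x using DirectSum.Decomposition.inductionOn ℳ with
  | zero => simp
  | @homogeneous i x =>
    have hrx : r • (x : M) ∈ ℳ (δ + i) := SetLike.GradedSMul.smul_mem hr x.2
    by_cases h : δ + i = d
    · subst h
      rw [DirectSum.decompose_of_mem_same ℳ hrx, add_sub_cancel_left,
        DirectSum.decompose_of_mem_same ℳ x.2]
    · rw [DirectSum.decompose_of_mem_ne ℳ hrx h, DirectSum.decompose_of_mem_ne ℳ x.2, smul_zero]
      rintro rfl
      exact h (add_sub_cancel _ _)
  | add x y hx hy =>
    simp only [smul_add, DirectSum.decompose_add, DirectSum.add_apply, AddSubgroup.coe_add] at hx hy ⊢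
    rw [hx, hy]

/-- The projections of a graded module. -/
noncomputable def BigradedProj.ofDecomposition (ℳ : ℤ × ℤ → AddSubgroup M)
    [DirectSum.Decomposition ℳ] [SetLike.GradedSMul (stdBigrading K m n) ℳ] :
    BigradedProj K m n M where
  π d :=
    { toFun := fun x => (DirectSum.decompose ℳ x d : M)
      map_zero' := by simp
      map_add' := by simp }
  π_C d a x := by
    have := decompose_smul ℳ (r := (C a : PolyRing K m n)) (δ := 0)
      (isWeightedHomogeneous_C (varDegree m n) a) d x
    rwa [sub_zero] at this
  π_X d v x := decompose_smul ℳ (isWeightedHomogeneous_X K (varDegree m n) v) d x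
  exists_sum x := by
    classical
    exact ⟨_, (DirectSum.sum_support_decompose ℳ x).symm⟩
  π_π d x := DirectSum.decompose_of_mem_same ℳ (SetLike.coe_mem _)
  π_π_ne d d' x h := DirectSum.decompose_of_mem_ne ℳ (SetLike.coe_mem _) h.symm

lemma isHomog_of_isHomogeneous (ℳ : ℤ × ℤ → AddSubgroup M) [DirectSum.Decomposition ℳ]
    [SetLike.GradedSMul (stdBigrading K m n) ℳ] {N : Submodule (PolyRing K m n) M}
    (hN : N.IsHomogeneous ℳ) : (BigradedProj.ofDecomposition (K := K) (m := m) (n := n) ℳ).IsHomog N :=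
  fun d _ hx => hN d hx

/-- The projections of a bigraded submodule. -/
def BigradedProj.restrict (G : BigradedProj K m n M) {N : Submodule (PolyRing K m n) M}
    (hN : G.IsHomog N) : BigradedProj K m n N where
  π d :=
    { toFun := fun x => ⟨G.π d x, hN d x x.2⟩
      map_zero' := by ext; simp
      map_add' := fun x y => by ext; simp }
  π_C d a x := by ext; exact G.π_C d a x
  π_X d v x := by ext; exact G.π_X d v x
  exists_sum x := by
    obtain ⟨s, hs⟩ := G.exists_sum (x : M)
    refine ⟨s, ?_⟩
    ext
    rw [AddSubmonoidClass.coe_finsetSum]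
    exact hs
  π_π d x := by ext; exact G.π_π d x
  π_π_ne d d' x h := by ext; exact G.π_π_ne d d' x h

variable [Module.Finite (PolyRing K m n) M]

/-- A bigraded submodule of small cohomological dimension has zero image in a Cohen–Macaulay
quotient. -/
lemma le_of_cd_lt {G : BigradedProj K m n M} {L L' N : Submodule (PolyRing K m n) M}
    (hL : G.IsHomog L) (hN : G.IsHomog N) (hNL : N ≤ L') {q : ℕ}
    (hC : ∀ i < q, Van (idealQ K m n) i (L' ⧸ L.submoduleOf L'))
    (hcd : cd (idealQ K m n) N < ((q : ℕ∞) : WithBot ℕ∞)) : N ≤ L := by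
  rcases subsingleton_or_nontrivial N with h | h
  · intro x hx
    have : (⟨x, hx⟩ : N) = 0 := Subsingleton.elim _ _
    rw [show x = 0 from congrArg Subtype.val this]
    exact L.zero_mem
  · obtain ⟨l, hl, hrad, hvan⟩ := exists_parameters_not_van (G.restrict hN)
    -- The number of parameters is an index of nonvanishing, hence at most `cd(Q, N)`. So Ischebeck
    -- applies to `N → L' / L`, and `1 - r` is then cancelled modulo the bigraded `L`.
    have hlq : l.length < q := by exact_mod_cast (le_cd hvan).trans_lt hcd
    obtain ⟨r, hr, hrx⟩ := exists_sub_one_smul_hom_eq_zero _ hC l hl hlq N hrad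
      ((L.submoduleOf L').mkQ.comp (Submodule.inclusion hNL))
    intro x hx
    refine BigradedProj.mem_of_one_sub_smul_mem hL hr ?_
    have := hrx ⟨x, hx⟩
    rw [← map_smul, LinearMap.comp_apply, Submodule.mkQ_apply, Submodule.Quotient.mk_eq_zero] at this
    exact this

omit [Module.Finite (PolyRing K m n) M] in
lemma van_step {J : Ideal (PolyRing K m n)} {L L' : Submodule (PolyRing K m n) M} (h : L ≤ L') :
    (∀ i, Van J i L → Van J i (L' ⧸ L.submoduleOf L') → Van J i L') ∧
      ∀ i, Van J i L' → Van J (i + 1) L → Van J i (L' ⧸ L.submoduleOf L') := by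
  have e := Submodule.submoduleOfEquivOfLe h
  have hex := LinearMap.exact_subtype_mkQ (L.submoduleOf L')
  exact ⟨fun i h₁ h₃ => Van.middle (Submodule.subtype_injective _) hex (Submodule.mkQ_surjective _)
      (Van.of_linearEquiv e.symm h₁) h₃,
    fun i h₂ h₁ => Van.right (Submodule.subtype_injective _) hex (Submodule.mkQ_surjective _) h₂
      (Van.of_linearEquiv e.symm h₁)⟩

theorem IsCMFiltration.isDimensionFiltration {ℳ : ℤ × ℤ → AddSubgroup M} [DirectSum.Decomposition ℳ]
    [SetLike.GradedSMul (stdBigrading K m n) ℳ] {F : LTSeries (Submodule (PolyRing K m n) M)}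
    (hF : IsCMFiltration ℳ F) : IsDimensionFiltration ℳ F := by
  refine ⟨hF.isFiltration, ?_⟩
  have hle : ∀ i : Fin F.length, F i.castSucc ≤ F i.succ := fun i => (F.step i).le
  choose q hq hq' using fun i => (hF.factor_cm i).exists_van (hF.cd_nonneg i)
  have hcdq : ∀ i, cd (idealQ K m n) (FactorModule F i) = (((q i : ℕ) : ℕ∞) : WithBot ℕ∞) :=
    fun i => cd_eq (fun j hj => hq i j hj.ne') (hq' i)
  have hmono : ∀ i j, i < j → q i < q j := by
    intro i j hij
    have := hF.cd_strictMono hij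
    simp only [hcdq] at this
    exact_mod_cast this
  -- Local cohomology of a filtration step vanishes in every degree above those of the factors below
  -- it, by building it up from the factors.
  have key : ∀ (k : ℕ) (hk : k < F.length + 1) (j : ℕ),
      (∀ i : Fin F.length, i.val < k → q i < j) → Van (idealQ K m n) j (F ⟨k, hk⟩) := by
    intro k
    induction k with
    | zero =>
      intro hk j _
      have : Subsingleton (F ⟨0, hk⟩) := by
        rw [Submodule.subsingleton_iff_eq_bot]
        exact hF.isFiltration.1
      exact Van.of_subsingleton
    | succ k ih =>
      intro hk j hj
      have hk' : k < F.length := Nat.lt_of_succ_lt_succ hk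
      exact (van_step (hle ⟨k, hk'⟩)).1 j
        (ih (Nat.lt_of_succ_lt hk) j fun i hi => hj i (hi.trans (Nat.lt_succ_self k)))
        (hq ⟨k, hk'⟩ j (hj ⟨k, hk'⟩ (Nat.lt_succ_self k)).ne')
  have hcast : ∀ (i : Fin F.length) (j : ℕ), q i ≤ j → Van (idealQ K m n) j (F i.castSucc) :=
    fun i j hj => key i.val _ j fun i' hi' => (hmono i' i hi').trans_le hj
  have hcd : ∀ i : Fin F.length, cd (idealQ K m n) (F i.succ) = (((q i : ℕ) : ℕ∞) : WithBot ℕ∞) := by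
    intro i
    refine cd_eq (fun j hj => (van_step (hle i)).1 j (hcast i j hj.le) (hq i j hj.ne')) fun h => ?_
    -- If `H^(q i)` of the larger step vanished, so would that of the factor, since `H^(q i + 1)` of
    -- the smaller step is zero.
    exact hq' i ((van_step (hle i)).2 _ h (hcast i _ (Nat.le_succ _)))
  intro i
  refine ⟨⟨hF.isFiltration.2.2 _, hle i, ?_⟩, ?_⟩
  · rw [hcd]
    exact cd_lt_of_forall_van (hcast i)
  · rintro N ⟨hN, hNle, hNcd⟩
    rw [hcd] at hNcd
    exact le_of_cd_lt (isHomog_of_isHomogeneous ℳ (hF.isFiltration.2.2 _))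
      (isHomog_of_isHomogeneous ℳ hN) hNle (fun j hj => hq i j hj.ne) hNcd

omit [Module.Finite (PolyRing K m n) M] in
lemma greatest_unique {ℳ : ℤ × ℤ → AddSubgroup M} [DirectSum.Decomposition ℳ]
    {A B A' B' : Submodule (PolyRing K m n) M} (h : A = B)
    (hA : IsGreatest {N : Submodule (PolyRing K m n) M | N.IsHomogeneous ℳ ∧ N ≤ A ∧
      cd (idealQ K m n) N < cd (idealQ K m n) A} A')
    (hB : IsGreatest {N : Submodule (PolyRing K m n) M | N.IsHomogeneous ℳ ∧ N ≤ B ∧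
      cd (idealQ K m n) N < cd (idealQ K m n) B} B') : A' = B' := by
  subst h
  exact hA.unique hB

omit [Module.Finite (PolyRing K m n) M] in
-- Each step determines the one below it as a greatest element, so two filtrations are compared by
-- the distance `k` from the top; their lengths need not be known to agree.
lemma IsDimensionFiltration.apply_eq {ℳ : ℤ × ℤ → AddSubgroup M} [DirectSum.Decomposition ℳ]
    {F G : LTSeries (Submodule (PolyRing K m n) M)}
    (hF : IsDimensionFiltration ℳ F) (hG : IsDimensionFiltration ℳ G) (k : ℕ) :
    ∀ (i j : ℕ) (hi : i + k = F.length) (hj : j + k = G.length),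
      F ⟨i, by omega⟩ = G ⟨j, by omega⟩ := by
  induction k with
  | zero =>
    intro i j hi hj
    have h₁ : (⟨i, by omega⟩ : Fin (F.length + 1)) = Fin.last _ := Fin.ext hi
    have h₂ : (⟨j, by omega⟩ : Fin (G.length + 1)) = Fin.last _ := Fin.ext hj
    rw [h₁, h₂]
    exact hF.isFiltration.2.1.trans hG.isFiltration.2.1.symm
  | succ k ih =>
    intro i j hi hj
    have h := ih (i + 1) (j + 1) (by omega) (by omega)
    exact greatest_unique h (hF.isGreatest ⟨i, by omega⟩) (hG.isGreatest ⟨j, by omega⟩)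

omit [Module.Finite (PolyRing K m n) M] in
lemma IsDimensionFiltration.length_le {ℳ : ℤ × ℤ → AddSubgroup M} [DirectSum.Decomposition ℳ]
    {F G : LTSeries (Submodule (PolyRing K m n) M)}
    (hF : IsDimensionFiltration ℳ F) (hG : IsDimensionFiltration ℳ G) : F.length ≤ G.length := by
  by_contra! hlt
  -- Were `F` longer, its step at distance `G.length` from the top would equal the bottom of `G`,
  -- which is zero, although it lies strictly above the bottom of `F`.
  have h := hF.apply_eq hG G.length (F.length - G.length) 0 (by omega) (by omega)
  have h0 : G ⟨0, by omega⟩ = ⊥ := hG.isFiltration.1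
  have h1 : F ⟨0, by omega⟩ < F ⟨F.length - G.length, by omega⟩ :=
    F.strictMono (Fin.mk_lt_mk.2 (by omega))
  rw [h, h0] at h1
  exact not_lt_bot h1

omit [Module.Finite (PolyRing K m n) M] in
theorem IsDimensionFiltration.unique {ℳ : ℤ × ℤ → AddSubgroup M} [DirectSum.Decomposition ℳ]
    {F G : LTSeries (Submodule (PolyRing K m n) M)}
    (hF : IsDimensionFiltration ℳ F) (hG : IsDimensionFiltration ℳ G) : F = G := by
  have hlen : F.length = G.length := le_antisymm (hF.length_le hG) (hG.length_le hF)
  refine RelSeries.ext hlen ?_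
  funext ⟨i, hi⟩
  exact hF.apply_eq hG (F.length - i) i i (by omega) (by omega)

end Filtrations

end BigradedCM

theorem mainTheorem3 {K : Type u} [Field K] {m n : ℕ}
    {M : Type u} [AddCommGroup M] [Module (BigradedCM.PolyRing K m n) M]
    [Module.Finite (BigradedCM.PolyRing K m n) M]
    (ℳ : ℤ × ℤ → AddSubgroup M) [DirectSum.Decomposition ℳ]
    [SetLike.GradedSMul (BigradedCM.stdBigrading K m n) ℳ]
    (F : LTSeries (Submodule (BigradedCM.PolyRing K m n) M))
    (hF : BigradedCM.IsCMFiltration ℳ F) :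
    BigradedCM.IsDimensionFiltration ℳ F ∧
      (∀ G : LTSeries (Submodule (BigradedCM.PolyRing K m n) M),
        BigradedCM.IsDimensionFiltration ℳ G → F = G) ∧
      (∀ F' : LTSeries (Submodule (BigradedCM.PolyRing K m n) M),
        BigradedCM.IsCMFiltration ℳ F' → F = F') :=
  ⟨hF.isDimensionFiltration, fun _ hG => hF.isDimensionFiltration.unique hG,
    fun _ hF' => hF.isDimensionFiltration.unique hF'.isDimensionFiltration⟩
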